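/- **Setting.** Let $(\mathbb X,\mathbb C,\|\cdot\|)$ and $(\mathbb B,\mathbb Y,\|\cdot\|)$ be dual pairs of normed vector spaces: real vector spaces with bilinear forms $\langle\cdot,\cdot\rangle$ that separate points on both sides, $\mathbb X$ and $\mathbb B$ normed (not necessarily complete), and $\mathbb C,\mathbb Y$ carrying the dual norms $\|c\|_*:=\sup_{\|x\|\le1}\langle x,c\rangle$, assumed finite. Let $\mathcal A:\mathbb X\to\mathbb B$ be linear and weakly continuous, $\mathbb K\subset\mathbb B$ a weakly closed convex cone, $\mathbb K^*:=\{y\in\mathbb Y:\langle k,y\rangle\ge0\ \forall k\in\mathbb K\}$, $b\in\mathbb B$, $c\in\mathbb C$. Let $x_1,\dots,x_n\in\mathbb X$ be linearly independent with $\|x_i\|=1$, $\|\cdot\|_{\mathfrak R}$ a norm on $\mathbb R^n$ with dual norm $\|\cdot\|_{\mathfrak R^*}$, and $\theta_{\mathcal P}\in\mathbb R$. Put $\mathcal A_n\alpha:=\sum_{i\le n}\alpha_i\mathcal Ax_i$, $\mathcal A_n^*y:=(\langle\mathcal Ax_i,y\rangle)_{i\le n}$, $\mathbf c:=(\langle x_i,c\rangle)_{i\le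 n}$, $\varrho_n:=\sup_{\|\alpha\|_{\mathfrak R}\le1}\|\alpha\|_{\ell_1}$, $\|\mathcal A\|:=\sup_{\|x\|\le1}\|\mathcal Ax\|$, and $$J_n:=\inf\{\alpha^\top\mathbf c:\ \mathcal A_n\alpha-b\in\mathbb K,\ \|\alpha\|_{\mathfrak R}\le\theta_{\mathcal P}\}.$$ Assume that this program is feasible and that there is $\gamma>0$ with $\|\mathcal A_n^*y\|_{\mathfrak R^*}\ge\gamma\|y\|_*$ for all $y\in\mathbb K^*$ and $\gamma\theta_{\mathcal P}>\|b\|$. For a lower bound $J_n^{\rm LB}\le J_n$ put $$\theta_{\mathcal D}:=\frac{\theta_{\mathcal P}\|\mathbf c\|_{\mathfrak R^*}-J_n^{\rm LB}}{\gamma\theta_{\mathcal P}-\|b\|}.$$ Let $\mathcal K$ be the set of extreme points of $\{y\in\mathbb K^*:\|y\|_*=1\}$, and assume that $\{y\in\mathbb K^*:\|y\|_*\le1\}$ is $\sigma(\mathbb Y,\mathbb B)$-compact (as is the case if $\mathbb Y$ is the norm dual of $\mathbb B$). Let $\mathbb P$ be a probability measure on $\mathbb Y$ supported on $\mathcal K$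 (all functionals $\langle v,\cdot\rangle$, $v\in\mathbb B$, being measurable), let $y_1,\dots,y_N$ be i.i.d. samples from $\mathbb P$, and $$J_{n,N}:=\min\{\alpha^\top\mathbf c:\ \alpha^\top\mathcal A_n^*y_j\ge\langle b,y_j\rangle\ (1\le j\le N),\ \|\alpha\|_{\mathfrak R}\le\theta_{\mathcal P}\}.\qquad(\mathcal P_{n,N})$$ With $\sigma_{\mathcal K}(\delta):=\sup_{y\in\mathcal K}\langle\delta,y\rangle$ and $p(\alpha,\zeta):=\mathbb P[y:\sigma_{\mathcal K}(-\mathcal A_n\alpha+b)<\langle-\mathcal A_n\alpha+b,y\rangle+\zeta]$, a function $h:\mathbb R^n\times[0,1)\to\mathbb R_+$ is a *tail bound* if $h(\alpha,\varepsilon)\ge\sup\{\zeta\ge0:p(\alpha,\zeta)\le\varepsilon\}$ for all $\alpha,\varepsilon$. For $\varepsilon\in[0,1]$ and $\beta>0$ let $$\mathsf N(n,\varepsilon,\beta):=\min\Big\{N\in\mathbb N:\ \sum_{i=0}^{n-1}\binom Ni\varepsilon^i(1-\varepsilon)^{N-i}\le\beta\Big\}$$ ($=\infty$ if there is no such $N$).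 **Theorem (Randomized approximation error).** (a) Let $h$ be a tail bound, $\varepsilon\in(0,1)$, $\beta>0$, $N\ge\mathsf N(n,\varepsilon,\beta)$, and suppose that almost surely $(\mathcal P_{n,N})$ has a unique optimizer $\alpha_N^\star$. Then $$\mathbb P^N\big[0\le J_n-J_{n,N}\le\theta_{\mathcal D}\,h(\alpha_N^\star,\varepsilon)\big]\ge1-\beta .$$ (b) Suppose $\|\mathcal A\|<\infty$ and $\theta_{\mathcal D}>0$, and let $g:\mathbb R_+\to[0,1]$ be non-decreasing with $g(r)\le\mathbb P[y:\|y-\kappa\|_*<r]$ for all $\kappa\in\mathcal K$, $r\ge0$. Put $z_n:=\big(\theta_{\mathcal D}(\theta_{\mathcal P}\varrho_n\|\mathcal A\|+\|b\|)\big)^{-1}$. For all $\varepsilon,\beta>0$ and $N\ge\mathsf N(n,g(z_n\varepsilon),\beta)$, $$\mathbb P^N\big[0\le J_n-J_{n,N}\le\varepsilon\big]\ge1-\beta .$$ (If the events are not measurable, the claim is that they contain measurable events of that probability.) -/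

import Mathlib

open MeasureTheory

noncomputable section

namespace ScenarioLP

/-! ### Dual pairs of normed vector spaces -/

/-- The norm induced on the second space by the norm of the first one and the bilinear form:
`‖c‖_* = sup_{‖x‖ ≤ 1} ⟨x, c⟩`. -/
def dualNorm {X C : Type*} [NormedAddCommGroup X] [NormedSpace ℝ X] [AddCommGroup C] [Module ℝ C]
    (p : X →ₗ[ℝ] C →ₗ[ℝ] ℝ) (c : C) : ℝ :=
  sSup {r : ℝ | ∃ x : X, ‖x‖ ≤ 1 ∧ r = p x c}

/-- The bilinear form `p` makes `(X, C, ‖·‖)` a dual pair of normed vector spaces: it separates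
points on both sides and the supremum in `dualNorm` is finite. -/
structure IsDualPair {X C : Type*} [NormedAddCommGroup X] [NormedSpace ℝ X] [AddCommGroup C]
    [Module ℝ C] (p : X →ₗ[ℝ] C →ₗ[ℝ] ℝ) : Prop where
  separatingLeft : p.SeparatingLeft
  separatingRight : p.SeparatingRight
  bddAbove : ∀ c : C, BddAbove {r : ℝ | ∃ x : X, ‖x‖ ≤ 1 ∧ r = p x c}

/-- `s` is closed for the weak topology `σ(E, F)` of the pairing `p`. -/
def IsWeaklyClosed {E F : Type*} [AddCommGroup E] [Module ℝ E] [AddCommGroup F] [Module ℝ F]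
    (p : E →ₗ[ℝ] F →ₗ[ℝ] ℝ) (s : Set E) : Prop :=
  IsClosed (X := WeakBilin p) s

/-- `s` is compact for the weak topology `σ(E, F)` of the pairing `p`. -/
def IsWeaklyCompact {E F : Type*} [AddCommGroup E] [Module ℝ E] [AddCommGroup F] [Module ℝ F]
    (p : E →ₗ[ℝ] F →ₗ[ℝ] ℝ) (s : Set E) : Prop :=
  IsCompact (X := WeakBilin p) s

/-- The operator norm `sup_{‖x‖ ≤ 1} ‖A x‖`. -/
def opNorm {X B : Type*} [NormedAddCommGroup X] [NormedSpace ℝ X] [NormedAddCommGroup B]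
    [NormedSpace ℝ B] (A : X →ₗ[ℝ] B) : ℝ :=
  sSup {r : ℝ | ∃ x : X, ‖x‖ ≤ 1 ∧ r = ‖A x‖}

/-! ### The semi-infinite program -/

/-- The data of the infinite linear program `inf {⟨x, c⟩ : A x - b ∈ K}` over two dual pairs,
together with the `n` basis elements `x i`, the norm `R` on `ℝⁿ` and the radius `θP` that define
its semi-infinite restriction. -/
structure Program (X C B Y : Type*) [NormedAddCommGroup X] [NormedSpace ℝ X]
    [AddCommGroup C] [Module ℝ C] [NormedAddCommGroup B] [NormedSpace ℝ B]
    [AddCommGroup Y] [Module ℝ Y] (n : ℕ) where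
  /-- the bilinear form of the pair `(X, C)` -/
  pX : X →ₗ[ℝ] C →ₗ[ℝ] ℝ
  /-- the bilinear form of the pair `(B, Y)` -/
  pB : B →ₗ[ℝ] Y →ₗ[ℝ] ℝ
  isDualPair_X : IsDualPair pX
  isDualPair_B : IsDualPair pB
  A : X →ₗ[ℝ] B
  A_continuous : Continuous (X := WeakBilin pX) (Y := WeakBilin pB) A
  K : PointedCone ℝ B
  K_closed : IsWeaklyClosed pB (K : Set B)
  c : C
  b : B
  x : Fin n → X
  x_linearIndependent : LinearIndependent ℝ x
  x_norm : ∀ i, ‖x i‖ = 1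
  R : Seminorm ℝ (Fin n → ℝ)
  R_definite : ∀ α, R α = 0 → α = 0
  θP : ℝ

namespace Program

variable {X C B Y : Type*} [NormedAddCommGroup X] [NormedSpace ℝ X]
  [AddCommGroup C] [Module ℝ C] [NormedAddCommGroup B] [NormedSpace ℝ B]
  [AddCommGroup Y] [Module ℝ Y] {n : ℕ} (L : Program X C B Y n)

/-- `A_n α = ∑ i, α i • A (x i)`. -/
def An (α : Fin n → ℝ) : B := ∑ i, α i • L.A (L.x i)

/-- `A_n^* y = (⟨A (x i), y⟩)_i`. -/
def AnAdj (y : Y) : Fin n → ℝ := fun i => L.pB (L.A (L.x i)) y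

/-- The cost vector `(⟨x i, c⟩)_i`. -/
def cvec : Fin n → ℝ := fun i => L.pX (L.x i) L.c

/-- The dual of the norm `R` on `ℝⁿ` for the standard inner product. -/
def RDual (v : Fin n → ℝ) : ℝ := sSup {r : ℝ | ∃ α : Fin n → ℝ, L.R α ≤ 1 ∧ r = α ⬝ᵥ v}

/-- The ratio `ϱ_n = sup_{R α ≤ 1} ‖α‖_{ℓ₁}`. -/
def rho : ℝ := sSup {r : ℝ | ∃ α : Fin n → ℝ, L.R α ≤ 1 ∧ r = ∑ i, |α i|}

/-- The feasible set of the semi-infinite program `(P_n)`. -/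
def feasible : Set (Fin n → ℝ) := {α | L.An α - L.b ∈ L.K ∧ L.R α ≤ L.θP}

/-- The optimal value `J_n` of `(P_n)`. -/
def Jn : ℝ := sInf ((fun α => α ⬝ᵥ L.cvec) '' L.feasible)

/-- The dual cone `K^* = {y : ⟨k, y⟩ ≥ 0 for all k ∈ K}`. -/
def dualCone : PointedCone ℝ Y := PointedCone.dual L.pB (L.K : Set B)

/-- The dual norm on `Y`. -/
def normY (y : Y) : ℝ := dualNorm L.pB y

/-- The set `𝒦` of extreme points of `{y ∈ K^* : ‖y‖_* = 1}`. -/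
def extremal : Set Y := Set.extremePoints ℝ {y : Y | y ∈ L.dualCone ∧ L.normY y = 1}

/-- Semi-infinite regularity with inf-sup constant `γ`. -/
structure Regular (γ : ℝ) : Prop where
  feasible_nonempty : L.feasible.Nonempty
  γ_pos : 0 < γ
  inf_sup : ∀ y ∈ L.dualCone, γ * L.normY y ≤ L.RDual (L.AnAdj y)
  θP_large : ‖L.b‖ < γ * L.θP

/-- The dual optimizer bound `θ_D` for the inf-sup constant `γ` and the lower bound `JLB`
of `J_n`. -/
def thetaD (γ JLB : ℝ) : ℝ := (L.θP * L.RDual L.cvec - JLB) / (γ * L.θP - ‖L.b‖)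

/-! ### The scenario program -/

/-- The feasible set of the scenario program `(P_{n,N})` for the samples `ω 0, …, ω (N-1)`. -/
def feasibleN {N : ℕ} (ω : Fin N → Y) : Set (Fin n → ℝ) :=
  {α | (∀ j, L.pB L.b (ω j) ≤ α ⬝ᵥ L.AnAdj (ω j)) ∧ L.R α ≤ L.θP}

/-- The optimal value `J_{n,N}` of `(P_{n,N})`. -/
def JnN {N : ℕ} (ω : Fin N → Y) : ℝ := sInf ((fun α => α ⬝ᵥ L.cvec) '' L.feasibleN ω)

/-- `α` is an optimizer of `(P_{n,N})`. -/
def IsOptimizer {N : ℕ} (ω : Fin N → Y) (α : Fin n → ℝ) : Prop :=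
  α ∈ L.feasibleN ω ∧ ∀ α' ∈ L.feasibleN ω, α ⬝ᵥ L.cvec ≤ α' ⬝ᵥ L.cvec

/-- `α` is the unique optimizer of `(P_{n,N})`. -/
def IsUniqueOptimizer {N : ℕ} (ω : Fin N → Y) (α : Fin n → ℝ) : Prop :=
  L.IsOptimizer ω α ∧ ∀ α', L.IsOptimizer ω α' → α' = α

/-- The support function `σ_𝒦(δ) = sup_{y ∈ 𝒦} ⟨δ, y⟩`. -/
def support (δ : B) : ℝ := sSup ((fun y => L.pB δ y) '' L.extremal)

variable [MeasurableSpace Y]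

/-- `p(α, ζ) = ℙ[y : σ_𝒦(-A_n α + b) < ⟨-A_n α + b, y⟩ + ζ]`. -/
def tailProb (P : Measure Y) (α : Fin n → ℝ) (ζ : ℝ) : ℝ :=
  P.real {y | L.support (-L.An α + L.b) < L.pB (-L.An α + L.b) y + ζ}

/-- `h` is a tail bound: nonnegative, with `h(α, ε) ≥ sup {ζ ≥ 0 : p(α, ζ) ≤ ε}`.  The level `ε`
ranges over `[0, 1)`: for `ε = 1` the supremum is infinite. -/
def IsTailBound (P : Measure Y) (h : (Fin n → ℝ) → ℝ → ℝ) : Prop :=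
  ∀ α : Fin n → ℝ, ∀ ε : ℝ, 0 ≤ ε → ε < 1 →
    0 ≤ h α ε ∧ ∀ ζ : ℝ, 0 ≤ ζ → L.tailProb P α ζ ≤ ε → ζ ≤ h α ε

/-- `g : ℝ₊ → [0, 1]` is non-decreasing and bounds from below the measure of the open balls
(for the dual norm) centred in `𝒦`. -/
structure IsBallBound (P : Measure Y) (g : ℝ → ℝ) : Prop where
  mono : MonotoneOn g (Set.Ici 0)
  mem_unit : ∀ r, 0 ≤ r → g r ∈ Set.Icc (0 : ℝ) 1
  le_ball : ∀ κ ∈ L.extremal, ∀ r, 0 ≤ r → g r ≤ P.real {y | L.normY (y - κ) < r}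

end Program

/-- The sample size `𝖭(n, ε, β) = min {N : ∑_{i<n} (N choose i) εⁱ (1-ε)^(N-i) ≤ β}`,
with value `⊤` if there is no such `N`. -/
def sampleSize (n : ℕ) (ε β : ℝ) : ℕ∞ :=
  ⨅ N ∈ {N : ℕ | ∑ i ∈ Finset.range n, (N.choose i : ℝ) * ε ^ i * (1 - ε) ^ (N - i) ≤ β}, (N : ℕ∞)

/-- The event `E` has probability at least `q`, in the sense that it contains a measurable event
of probability at least `q` (which is the usual meaning if `E` is measurable). -/
def ProbAtLeast {Ω : Type*} [MeasurableSpace Ω] (μ : Measure Ω) (E : Set Ω) (q : ℝ) : Prop :=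
  ∃ G : Set Ω, MeasurableSet G ∧ G ⊆ E ∧ q ≤ μ.real G

end ScenarioLP

end

/-!
The gap `J_n - J_{n,N}` is controlled by the worst violated constraint at the scenario optimizer
`α`.  By minimax duality over the compact set `R α ≤ θP`, dual multipliers with Lagrangian bound
`v < J_n` exist, and the inf-sup condition bounds their norm by `θ_D`.  Hence a residual of at
most `ζ` on the unit ball of the dual cone costs at most `θ_D ζ` in the optimal value, and by
Krein-Milman it is enough to bound the residual on the extreme points.  If a new sample violates
`α` with probability at most `ε`, then the tail bound at level `ε` dominates the support function.
If the gap exceeds `ε`, then a whole ball around some extreme point consists of violated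
constraints, so that the violation probability is at least `g (z_n ε)`.

The violation probability is estimated as by Campi and Garatti.  In a strictly convex program in
dimension `n` whose constraint functions have atomless laws, the optimizer is, by Helly's theorem,
that of at most `n` active constraints.  Completed by the least slack ones of the remaining
constraints, they form almost surely the only set of `n` scenarios such that all other scenarios
have more slack at the optimizer of the set.  If `V` is the probability that a new scenario has
more slack than `n` given ones at their optimizer, then `E[V ^ m]` is the probability that the
first `n` of `n + m` scenarios form this set, and by exchangeability
`(n + m).choose n * E[V ^ m] = 1`.  These are the moments of the distribution `Beta(1, n)`, and the
same count restricted to `V < 1 - ε` gives the binomial tail.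

The linear scenario program is neither strictly convex nor atomless.  It is the limit `t → 0` of
programs with objective `α ⬝ᵥ c + t * α ⬝ᵥ α` and constraints relaxed by `t` times uniform noise;
the violation probability is lower semicontinuous because strict violation is an open condition.
-/

namespace ScenarioLP

/-- The probability that a binomial variable with parameters `N` and `ε` is smaller than `n`. -/
noncomputable def binomTail (n N : ℕ) (ε : ℝ) : ℝ :=
  ∑ i ∈ Finset.range n, (N.choose i : ℝ) * ε ^ i * (1 - ε) ^ (N - i)

lemma binomTail_eq_eval_sum_bernsteinPolynomial (n N : ℕ) (ε : ℝ) :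
    binomTail n N ε = (∑ i ∈ Finset.range n, bernsteinPolynomial ℝ N i).eval ε := by
  simp [binomTail, bernsteinPolynomial, Polynomial.eval_finsetSum]

lemma continuous_binomTail (n N : ℕ) : Continuous (binomTail n N) := by
  unfold binomTail; fun_prop

lemma binomTail_succ_left (n N : ℕ) (ε : ℝ) :
    binomTail (n + 1) N ε = binomTail n N ε + N.choose n * ε ^ n * (1 - ε) ^ (N - n) :=
  Finset.sum_range_succ _ _

lemma binomTail_of_lt {n N : ℕ} (h : N < n) (ε : ℝ) : binomTail n N ε = 1 := by
  have hle : N + 1 ≤ n := h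
  induction n, hle using Nat.le_induction with
  | base =>
    have hsum := add_pow ε (1 - ε) N
    rw [add_sub_cancel, one_pow] at hsum
    rw [hsum, binomTail]
    exact Finset.sum_congr rfl fun i _ => by ring
  | succ n hn ih => rw [binomTail_succ_left, ih hn, Nat.choose_eq_zero_of_lt hn]; simp

lemma binomTail_zero_right (n N : ℕ) : binomTail (n + 1) N 0 = 1 := by
  rw [binomTail, Finset.sum_range_succ']
  simp

lemma binomTail_one_right (n m : ℕ) : binomTail n (n + m) 1 = 0 := by
  refine Finset.sum_eq_zero fun i hi => ?_
  have : n + m - i ≠ 0 := by have := Finset.mem_range.1 hi; omega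
  simp [this]

lemma choose_succ_mul_pow_mul_pow (N i : ℕ) (ε : ℝ) :
    ((N + 1).choose (i + 1) : ℝ) * ε ^ (i + 1) * (1 - ε) ^ (N + 1 - (i + 1)) =
      ε * (N.choose i * ε ^ i * (1 - ε) ^ (N - i)) +
      (1 - ε) * (N.choose (i + 1) * ε ^ (i + 1) * (1 - ε) ^ (N - (i + 1))) := by
  rw [Nat.choose_succ_succ, Nat.add_sub_add_right]
  rcases Nat.lt_or_ge i N with h | h
  · rw [show N - i = N - (i + 1) + 1 by omega]
    push_cast
    ring
  · rw [Nat.choose_eq_zero_of_lt (show N < i + 1 by omega)]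
    push_cast
    ring

lemma binomTail_succ_succ (n N : ℕ) (ε : ℝ) :
    binomTail (n + 1) (N + 1) ε =
      binomTail (n + 1) N ε - ε * (N.choose n * ε ^ n * (1 - ε) ^ (N - n)) := by
  induction n with
  | zero => simp [binomTail, pow_succ]; ring
  | succ n ih =>
    rw [binomTail_succ_left (n + 1), ih, choose_succ_mul_pow_mul_pow, binomTail_succ_left (n + 1)]
    ring

lemma binomTail_antitone (n : ℕ) {ε : ℝ} (h0 : 0 ≤ ε) (h1 : ε ≤ 1) :
    Antitone fun N => binomTail n N ε := by
  refine antitone_nat_of_succ_le fun N => ?_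
  cases n with
  | zero => simp [binomTail]
  | succ n =>
    have : 0 ≤ 1 - ε := sub_nonneg.2 h1
    rw [binomTail_succ_succ, sub_le_self_iff]
    positivity

lemma sum_derivative_bernsteinPolynomial (n N : ℕ) :
    ∑ i ∈ Finset.range (n + 1), Polynomial.derivative (bernsteinPolynomial ℝ (N + 1) i) =
      -(N + 1) * bernsteinPolynomial ℝ N n := by
  induction n with
  | zero => simp [bernsteinPolynomial.derivative_zero]
  | succ n ih =>
    rw [Finset.sum_range_succ, ih, bernsteinPolynomial.derivative_succ]
    simp only [add_tsub_cancel_right, Nat.cast_add, Nat.cast_one]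
    ring

lemma hasDerivAt_binomTail (n m : ℕ) (ε : ℝ) :
    HasDerivAt (binomTail (n + 1) (n + 1 + m))
      (-(((n + 1 + m).choose (n + 1) : ℝ) * (n + 1) * ε ^ n * (1 - ε) ^ m)) ε := by
  have hder := (∑ i ∈ Finset.range (n + 1), bernsteinPolynomial ℝ (n + m + 1) i).hasDerivAt ε
  rw [Polynomial.derivative_sum, sum_derivative_bernsteinPolynomial] at hder
  have hchoose : ((n + m + 1 : ℕ) : ℝ) * (n + m).choose n =
      ((n + m + 1).choose (n + 1) : ℝ) * (n + 1) := by
    exact_mod_cast Nat.add_one_mul_choose_eq (n + m) n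
  rw [show n + 1 + m = n + m + 1 by ring,
    funext (binomTail_eq_eval_sum_bernsteinPolynomial (n + 1) (n + m + 1)), ← hchoose]
  refine hder.congr_deriv ?_
  simp only [bernsteinPolynomial, Nat.add_sub_cancel_left, Polynomial.eval_mul, Polynomial.eval_neg,
    Polynomial.eval_add, Polynomial.eval_natCast, Polynomial.eval_one, Polynomial.eval_pow,
    Polynomial.eval_X, Polynomial.eval_sub]
  push_cast
  ring

section BetaMeasure

open ProbabilityTheory

lemma beta_one_natCast_add_one (n : ℕ) : beta 1 (n + 1) = 1 / (n + 1) := by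
  have hΓ : Real.Gamma (n + 1) ≠ 0 := (Real.Gamma_pos_of_pos (by positivity)).ne'
  rw [beta, Real.Gamma_one, add_comm 1 ((n : ℝ) + 1), Real.Gamma_add_one (s := n + 1)
    (by positivity), one_mul, mul_comm, div_mul_cancel_left₀ hΓ, one_div]

lemma measurable_betaPDF (α β : ℝ) : Measurable (betaPDF α β) :=
  (measurable_betaPDFReal α β).ennreal_ofReal

lemma setIntegral_Iio_betaMeasure_one (n : ℕ) (f : ℝ → ℝ) {t : ℝ} (h0 : 0 ≤ t) (h1 : t ≤ 1) :
    ∫ v in Set.Iio t, f v ∂betaMeasure 1 (n + 1) =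
      ∫ v in (0 : ℝ)..t, (n + 1) * (1 - v) ^ n * f v := by
  rw [betaMeasure, setIntegral_withDensity_eq_setIntegral_toReal_smul (measurable_betaPDF _ _)
      (.of_forall fun _ => ENNReal.ofReal_lt_top) _ measurableSet_Iio,
    intervalIntegral.integral_of_le h0, integral_Ioc_eq_integral_Ioo,
    setIntegral_eq_of_subset_of_forall_sdiff_eq_zero measurableSet_Iio
      (Set.Ioo_subset_Iio_self (a := 0))]
  · refine setIntegral_congr_fun measurableSet_Ioo fun v hv => ?_
    have hv1 : 0 ≤ 1 - v := by linarith [hv.2]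
    have hpdf : betaPDF 1 (n + 1) v = ENNReal.ofReal ((n + 1) * (1 - v) ^ n) := by
      rw [betaPDF_of_pos_lt_one hv.1 (hv.2.trans_le h1), beta_one_natCast_add_one]
      simp
    simp only [hpdf, smul_eq_mul]
    rw [ENNReal.toReal_ofReal (by positivity)]
  · intro v hv
    have hv0 : v ≤ 0 := not_lt.1 fun h => hv.2 ⟨h, hv.1⟩
    simp [betaPDF_eq_zero_of_nonpos hv0]

lemma choose_mul_setIntegral_pow_betaMeasure (n m : ℕ) {t : ℝ} (h0 : 0 ≤ t) (h1 : t ≤ 1) :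
    ((n + 1 + m).choose (n + 1) : ℝ) * ∫ v in Set.Iio t, v ^ m ∂betaMeasure 1 (n + 1) =
      binomTail (n + 1) (n + 1 + m) (1 - t) := by
  have hderiv (v : ℝ) : HasDerivAt (fun v => binomTail (n + 1) (n + 1 + m) (1 - v))
      (((n + 1 + m).choose (n + 1) : ℝ) * ((n + 1) * (1 - v) ^ n * v ^ m)) v := by
    refine ((hasDerivAt_binomTail n m (1 - v)).comp v
      ((hasDerivAt_id v).const_sub 1)).congr_deriv ?_
    rw [sub_sub_cancel]
    ring
  rw [setIntegral_Iio_betaMeasure_one n _ h0 h1, ← intervalIntegral.integral_const_mul,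
    intervalIntegral.integral_eq_sub_of_hasDerivAt (fun v _ => hderiv v)
      (Continuous.intervalIntegrable (by fun_prop) _ _),
    sub_zero, binomTail_one_right, sub_zero]

lemma ae_betaMeasure_mem_Ioo (α β : ℝ) : ∀ᵐ v ∂betaMeasure α β, v ∈ Set.Ioo (0 : ℝ) 1 := by
  rw [betaMeasure, ae_withDensity_iff (measurable_betaPDF α β)]
  refine .of_forall fun v hv => ⟨?_, ?_⟩
  · by_contra! h; exact hv (betaPDF_eq_zero_of_nonpos h)
  · by_contra! h; exact hv (betaPDF_eq_zero_of_one_le h)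

lemma choose_mul_integral_pow_betaMeasure (n m : ℕ) :
    ((n + 1 + m).choose (n + 1) : ℝ) * ∫ v, v ^ m ∂betaMeasure 1 (n + 1) = 1 := by
  have h := choose_mul_setIntegral_pow_betaMeasure n m zero_le_one le_rfl
  rw [sub_self, binomTail_zero_right, setIntegral_eq_integral_of_ae_compl_eq_zero] at h
  · exact h
  · filter_upwards [ae_betaMeasure_mem_Ioo 1 (n + 1)] with v hv hv'
    exact absurd hv.2 hv'

end BetaMeasure

section Moments

variable {μ ν : Measure ℝ} [IsFiniteMeasure μ] [IsFiniteMeasure ν] {a b : ℝ}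

lemma integrable_of_continuous_of_ae_mem_Icc (hμ : ∀ᵐ x ∂μ, x ∈ Set.Icc a b) {f : ℝ → ℝ}
    (hf : Continuous f) : Integrable f μ := by
  rw [← Measure.restrict_eq_self_of_ae_mem hμ]
  exact hf.continuousOn.integrableOn_compact isCompact_Icc

lemma integral_eval_eq_of_forall_integral_pow_eq (hμ : ∀ᵐ x ∂μ, x ∈ Set.Icc a b)
    (hν : ∀ᵐ x ∂ν, x ∈ Set.Icc a b) (h : ∀ m : ℕ, ∫ x, x ^ m ∂μ = ∫ x, x ^ m ∂ν)
    (p : Polynomial ℝ) : ∫ x, p.eval x ∂μ = ∫ x, p.eval x ∂ν := by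
  simp only [Polynomial.eval_eq_sum_range]
  rw [integral_finsetSum _ fun i _ => integrable_of_continuous_of_ae_mem_Icc hμ (by fun_prop),
    integral_finsetSum _ fun i _ => integrable_of_continuous_of_ae_mem_Icc hν (by fun_prop)]
  simp_rw [integral_const_mul, h]

lemma abs_integral_sub_le_of_forall_mem_Icc (hμ : ∀ᵐ x ∂μ, x ∈ Set.Icc a b) {f g : ℝ → ℝ}
    (hf : Continuous f) (hg : Continuous g) {δ : ℝ} (h : ∀ x ∈ Set.Icc a b, |f x - g x| ≤ δ) :
    |∫ x, f x ∂μ - ∫ x, g x ∂μ| ≤ δ * μ.real Set.univ := by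
  rw [← integral_sub (integrable_of_continuous_of_ae_mem_Icc hμ hf)
    (integrable_of_continuous_of_ae_mem_Icc hμ hg)]
  exact norm_integral_le_of_norm_le_const (f := fun x => f x - g x) (hμ.mono h)

lemma ext_of_forall_integral_pow_eq (hμ : ∀ᵐ x ∂μ, x ∈ Set.Icc a b)
    (hν : ∀ᵐ x ∂ν, x ∈ Set.Icc a b) (h : ∀ m : ℕ, ∫ x, x ^ m ∂μ = ∫ x, x ^ m ∂ν) : μ = ν := by
  refine ext_of_forall_integral_eq_of_IsFiniteMeasure fun f => ?_
  have hbound (δ : ℝ) (hδ : 0 < δ) :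
      |∫ x, f x ∂μ - ∫ x, f x ∂ν| ≤ δ * (μ.real Set.univ + ν.real Set.univ) := by
    obtain ⟨p, hp⟩ := exists_polynomial_near_of_continuousOn a b f f.continuous.continuousOn δ hδ
    have happrox : ∀ x ∈ Set.Icc a b, |f x - p.eval x| ≤ δ := fun x hx => by
      rw [abs_sub_comm]
      exact (hp x hx).le
    have h1 := abs_integral_sub_le_of_forall_mem_Icc hμ f.continuous p.continuous happrox
    have h2 := abs_integral_sub_le_of_forall_mem_Icc hν f.continuous p.continuous happrox
    rw [integral_eval_eq_of_forall_integral_pow_eq hμ hν h p, abs_le] at h1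
    rw [abs_le] at h2 ⊢
    constructor <;> linarith
  have hlim : Filter.Tendsto (fun δ : ℝ => δ * (μ.real Set.univ + ν.real Set.univ))
      (nhdsWithin 0 (Set.Ioi 0)) (nhds 0) :=
    ((continuous_mul_const _).tendsto' 0 0 (zero_mul _)).mono_left nhdsWithin_le_nhds
  rw [← sub_eq_zero, ← abs_nonpos_iff]
  exact ge_of_tendsto hlim (eventually_mem_nhdsWithin.mono hbound)

end Moments

lemma choose_mul_setIntegral_pow_of_moments {Ω : Type*} [MeasurableSpace Ω] {μ : Measure Ω}
    [IsProbabilityMeasure μ] {V : Ω → ℝ} (hV : Measurable V) (hV01 : ∀ x, V x ∈ Set.Icc (0 : ℝ) 1)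
    {n : ℕ} (h : ∀ m : ℕ, ((n + 1 + m).choose (n + 1) : ℝ) * ∫ x, V x ^ m ∂μ = 1)
    {t : ℝ} (h0 : 0 ≤ t) (h1 : t ≤ 1) (m : ℕ) :
    ((n + 1 + m).choose (n + 1) : ℝ) * ∫ x in {x | V x < t}, V x ^ m ∂μ =
      binomTail (n + 1) (n + 1 + m) (1 - t) := by
  have : IsProbabilityMeasure (μ.map V) := Measure.isProbabilityMeasure_map hV.aemeasurable
  have : IsProbabilityMeasure (ProbabilityTheory.betaMeasure 1 (n + 1)) :=
    ProbabilityTheory.isProbabilityMeasureBeta one_pos (by positivity)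
  have hlaw : μ.map V = ProbabilityTheory.betaMeasure 1 (n + 1) := by
    refine ext_of_forall_integral_pow_eq
      ((ae_map_iff hV.aemeasurable measurableSet_Icc).2 (.of_forall hV01))
      ((ae_betaMeasure_mem_Ioo _ _).mono fun _ hv => Set.Ioo_subset_Icc_self hv) fun m => ?_
    have hpos : (0 : ℝ) < (n + 1 + m).choose (n + 1) := by
      exact_mod_cast Nat.choose_pos (by omega)
    rw [integral_map hV.aemeasurable (by fun_prop)]
    exact mul_left_cancel₀ hpos.ne' ((h m).trans (choose_mul_integral_pow_betaMeasure n m).symm)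
  rw [← choose_mul_setIntegral_pow_betaMeasure n m h0 h1, ← hlaw,
    setIntegral_map measurableSet_Iio (by fun_prop) hV.aemeasurable]
  rfl

section Measurability

variable {Ω E : Type*} [MeasurableSpace Ω] [PseudoMetricSpace E]

lemma measurableSet_exists_mem_nonpos {A : Set E} (hA : IsCompact A) {F : Ω → E → ℝ}
    (hcont : ∀ ω, Continuous (F ω)) (hmeas : ∀ x, Measurable fun ω => F ω x) :
    MeasurableSet {ω | ∃ x ∈ A, F ω x ≤ 0} := by
  obtain ⟨D, hDA, hD, hAD⟩ := hA.isSeparable.exists_countable_dense_subset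
  have heq : {ω | ∃ x ∈ A, F ω x ≤ 0} = ⋂ k : ℕ, ⋃ d ∈ D, {ω | F ω d < 1 / (k + 1)} := by
    ext ω
    simp only [Set.mem_ofPred_eq, Set.mem_iInter, Set.mem_iUnion, exists_prop]
    constructor
    · rintro ⟨x, hx, hFx⟩ k
      have hopen : IsOpen {y | F ω y < 1 / ((k : ℝ) + 1)} := isOpen_lt (hcont ω) continuous_const
      obtain ⟨d, hdlt, hdD⟩ :=
        mem_closure_iff.1 (hAD hx) _ hopen (hFx.trans_lt Nat.one_div_pos_of_nat)
      exact ⟨d, hdD, hdlt⟩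
    · intro h
      obtain ⟨d, hdD, -⟩ := h 0
      obtain ⟨x, hx, hmin⟩ := hA.exists_isMinOn ⟨d, hDA hdD⟩ (hcont ω).continuousOn
      refine ⟨x, hx, ge_of_tendsto' tendsto_one_div_add_atTop_nhds_zero_nat fun k => ?_⟩
      obtain ⟨d, hdD, hd⟩ := h k
      exact (hmin (hDA hdD)).trans hd.le
  rw [heq]
  exact .iInter fun k => .biUnion hD fun d _ => measurableSet_lt (hmeas d) measurable_const

end Measurability

/-- A family of convex constraints `constr z x ≤ 0`, indexed by the scenarios `z`, for the
minimization of a strictly convex objective over a compact convex domain.  A common feasible point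
makes every choice of scenarios solvable. -/
structure ConvexScenario (Z E : Type*) [MeasurableSpace Z] [NormedAddCommGroup E]
    [NormedSpace ℝ E] where
  domain : Set E
  isCompact_domain : IsCompact domain
  obj : E → ℝ
  continuous_obj : Continuous obj
  strictConvexOn_obj : StrictConvexOn ℝ domain obj
  constr : Z → E → ℝ
  continuous_constr : ∀ z, Continuous (constr z)
  convexOn_constr : ∀ z, ConvexOn ℝ domain (constr z)
  measurable_constr : ∀ x, Measurable fun z => constr z x
  exists_common_feasible : ∃ x ∈ domain, ∀ z, constr z x ≤ 0

namespace ConvexScenario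

variable {Z E : Type*} [MeasurableSpace Z] [NormedAddCommGroup E] [NormedSpace ℝ E]
  (M : ConvexScenario Z E) {ι κ : Type*}

/-- The feasible set for the scenarios `z i`. -/
def feas (z : ι → Z) : Set E := {x | x ∈ M.domain ∧ ∀ i, M.constr (z i) x ≤ 0}

lemma feas_subset_feas_restrict (z : ι → Z) (I : Finset ι) : M.feas z ⊆ M.feas (I.restrict z) :=
  fun _ hx => ⟨hx.1, fun i => hx.2 i⟩

lemma feas_restrict_subset_feas_restrict (z : ι → Z) {I J : Finset ι} (h : I ⊆ J) :
    M.feas (J.restrict z) ⊆ M.feas (I.restrict z) :=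
  fun _ hx => ⟨hx.1, fun i => hx.2 ⟨i, h i.2⟩⟩

lemma convex_domain : Convex ℝ M.domain := M.strictConvexOn_obj.1

lemma convex_feas (z : ι → Z) : Convex ℝ (M.feas z) := by
  intro x hx y hy a b ha hb hab
  exact ⟨M.convex_domain hx.1 hy.1 ha hb hab, fun i =>
    ((M.convexOn_constr (z i)).convex_le 0 ⟨hx.1, hx.2 i⟩ ⟨hy.1, hy.2 i⟩ ha hb hab).2⟩

lemma isCompact_feas (z : ι → Z) : IsCompact (M.feas z) := by
  have : M.feas z = M.domain ∩ ⋂ i, {x | M.constr (z i) x ≤ 0} := by ext; simp [feas]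
  rw [this]
  exact M.isCompact_domain.inter_right
    (isClosed_iInter fun i => isClosed_le (M.continuous_constr _) continuous_const)

lemma exists_isMinOn_feas (z : ι → Z) : ∃ x ∈ M.feas z, IsMinOn M.obj (M.feas z) x := by
  obtain ⟨x, hx, hfeas⟩ := M.exists_common_feasible
  exact (M.isCompact_feas z).exists_isMinOn ⟨x, hx, fun i => hfeas _⟩ M.continuous_obj.continuousOn

/-- The optimizer for the scenarios `z i`. -/
noncomputable def opt (z : ι → Z) : E := (M.exists_isMinOn_feas z).choose

lemma opt_mem (z : ι → Z) : M.opt z ∈ M.feas z := (M.exists_isMinOn_feas z).choose_spec.1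

lemma isMinOn_opt (z : ι → Z) : IsMinOn M.obj (M.feas z) (M.opt z) :=
  (M.exists_isMinOn_feas z).choose_spec.2

lemma constr_opt_nonpos (z : ι → Z) (i : ι) : M.constr (z i) (M.opt z) ≤ 0 := (M.opt_mem z).2 i

variable {M} in
lemma eq_opt {z : ι → Z} {x : E} (hx : x ∈ M.feas z) (h : M.obj x ≤ M.obj (M.opt z)) :
    x = M.opt z :=
  (M.strictConvexOn_obj.subset (fun _ hy => hy.1) (M.convex_feas z)).eq_of_isMinOn
    (fun _ hy => h.trans (M.isMinOn_opt z hy)) (M.isMinOn_opt z) hx (M.opt_mem z)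

variable {M} in
lemma opt_eq_of_feas_subset {w : κ → Z} {z : ι → Z} (h : M.feas z ⊆ M.feas w)
    (hw : M.opt w ∈ M.feas z) : M.opt w = M.opt z :=
  eq_opt hw (M.isMinOn_opt w (h (M.opt_mem z)))

/-- If the active constraints alone had a better optimizer, the segment towards it would start
inside all inactive constraints. -/
lemma opt_restrict_filter_active [Fintype ι] (z : ι → Z) :
    M.opt ((Finset.univ.filter fun i => M.constr (z i) (M.opt z) = 0).restrict z) = M.opt z := by
  set I := Finset.univ.filter fun i => M.constr (z i) (M.opt z) = 0 with hI
  set x := M.opt z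
  set y := M.opt (I.restrict z)
  suffices h : M.obj x ≤ M.obj y from
    (eq_opt (M.feas_subset_feas_restrict z I (M.opt_mem z)) h).symm
  by_contra! hlt
  have hxD : x ∈ M.domain := (M.opt_mem z).1
  have hyD : y ∈ M.domain := (M.opt_mem _).1
  have hinactive : ∀ᶠ r : ℝ in nhdsWithin 0 (Set.Ioi 0), ∀ i, M.constr (z i) x ≠ 0 →
      M.constr (z i) ((1 - r) • x + r • y) < 0 := by
    refine Filter.eventually_all.2 fun i => Filter.eventually_imp_distrib_left.2 fun hi => ?_
    have hlim : Filter.Tendsto (fun r : ℝ => M.constr (z i) ((1 - r) • x + r • y))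
        (nhdsWithin 0 (Set.Ioi 0)) (nhds (M.constr (z i) x)) := by
      refine (((M.continuous_constr (z i)).comp ?_).tendsto' 0 _ (by simp)).mono_left
        nhdsWithin_le_nhds
      fun_prop
    exact hlim.eventually_lt_const ((M.constr_opt_nonpos z i).lt_of_ne hi)
  have hlt_one : ∀ᶠ r : ℝ in nhdsWithin 0 (Set.Ioi 0), r < 1 :=
    mem_nhdsWithin_of_mem_nhds (Iio_mem_nhds one_pos)
  obtain ⟨r, ⟨hr, hr1⟩, hr0⟩ := ((hinactive.and hlt_one).and self_mem_nhdsWithin).exists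
  have hr0 : 0 < r := hr0
  have h1r : 0 < 1 - r := sub_pos.2 hr1
  have hfeas : (1 - r) • x + r • y ∈ M.feas z := by
    refine ⟨M.convex_domain hxD hyD h1r.le hr0.le (by ring), fun i => ?_⟩
    by_cases hi : M.constr (z i) x = 0
    · have hyi : M.constr (z i) y ≤ 0 := M.constr_opt_nonpos (I.restrict z) ⟨i, by simp [hI, hi]⟩
      exact ((M.convexOn_constr (z i)).convex_le 0 ⟨hxD, hi.le⟩ ⟨hyD, hyi⟩ h1r.le hr0.le
        (by ring)).2
    · exact (hr i hi).le
  have hmin : M.obj x ≤ M.obj ((1 - r) • x + r • y) := M.isMinOn_opt z hfeas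
  have hconv := M.strictConvexOn_obj.convexOn.2 hxD hyD h1r.le hr0.le (by ring)
  simp only [smul_eq_mul] at hconv
  nlinarith

section FiniteDimensional

variable [FiniteDimensional ℝ E]

lemma exists_opt_restrict_eq (z : ι → Z) (J : Finset ι) :
    ∃ I ⊆ J, I.card ≤ Module.finrank ℝ E ∧ M.opt (I.restrict z) = M.opt (J.restrict z) := by
  classical
  by_contra! hcon
  have hlt (I : Finset ι) (hI : I ⊆ J) (hcard : I.card ≤ Module.finrank ℝ E) :
      M.obj (M.opt (I.restrict z)) < M.obj (M.opt (J.restrict z)) := by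
    by_contra! hle
    exact hcon I hI hcard
      (eq_opt (M.feas_restrict_subset_feas_restrict z hI (M.opt_mem _)) hle).symm
  let F : Option ι → Set E := fun o =>
    o.elim {x ∈ M.domain | M.obj x < M.obj (M.opt (J.restrict z))}
      fun i => {x ∈ M.domain | M.constr (z i) x ≤ 0}
  have hconv : ∀ o ∈ Finset.insertNone J, Convex ℝ (F o) := by
    rintro (_ | i) -
    · exact M.strictConvexOn_obj.convexOn.convex_lt _
    · exact (M.convexOn_constr _).convex_le _
  have hinter : ∀ O ⊆ Finset.insertNone J, O.card ≤ Module.finrank ℝ E + 1 →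
      (⋂ o ∈ O, F o).Nonempty := by
    intro O hO hcard
    have hIJ : O.eraseNone ⊆ J := fun i hi => by simpa using hO (Finset.mem_eraseNone.1 hi)
    by_cases hnone : none ∈ O
    · have hIcard : O.eraseNone.card ≤ Module.finrank ℝ E := by
        have := Finset.card_insertNone O.eraseNone
        rw [Finset.insertNone_eraseNone, Finset.insert_eq_of_mem hnone] at this
        omega
      refine ⟨M.opt (O.eraseNone.restrict z), Set.mem_iInter₂.2 ?_⟩
      rintro (_ | i) ho
      · exact ⟨(M.opt_mem _).1, hlt _ hIJ hIcard⟩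
      · exact ⟨(M.opt_mem _).1, (M.opt_mem (O.eraseNone.restrict z)).2 ⟨i, by simpa using ho⟩⟩
    · refine ⟨M.opt (J.restrict z), Set.mem_iInter₂.2 ?_⟩
      rintro (_ | i) ho
      · exact absurd ho hnone
      · exact ⟨(M.opt_mem _).1, (M.opt_mem (J.restrict z)).2 ⟨i, hIJ (by simpa using ho)⟩⟩
  obtain ⟨x, hx⟩ := Convex.helly_theorem' hconv hinter
  rw [Set.mem_iInter₂] at hx
  have hx0 : x ∈ M.domain ∧ M.obj x < M.obj (M.opt (J.restrict z)) := hx none (by simp)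
  have hxJ : x ∈ M.feas (J.restrict z) := ⟨hx0.1, fun i => (hx (some i.1) (by simp)).2⟩
  exact absurd (M.isMinOn_opt _ hxJ) (not_le.2 hx0.2)

lemma exists_active_opt_restrict_eq [Finite ι] (z : ι → Z) :
    ∃ I : Finset ι, I.card ≤ Module.finrank ℝ E ∧ (∀ i ∈ I, M.constr (z i) (M.opt z) = 0) ∧
      M.opt (I.restrict z) = M.opt z := by
  have := Fintype.ofFinite ι
  obtain ⟨I, hI, hcard, hopt⟩ :=
    M.exists_opt_restrict_eq z (Finset.univ.filter fun i => M.constr (z i) (M.opt z) = 0)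
  exact ⟨I, hcard, fun i hi => (Finset.mem_filter.1 (hI hi)).2,
    hopt.trans (M.opt_restrict_filter_active z)⟩

end FiniteDimensional

lemma measurable_constr_comp [FiniteDimensional ℝ E] [MeasurableSpace E] [BorelSpace E]
    {Ω : Type*} [MeasurableSpace Ω] {g : Ω → Z} {x : Ω → E} (hg : Measurable g)
    (hx : Measurable x) :
    Measurable fun ω => M.constr (g ω) (x ω) := by
  have := FiniteDimensional.proper_real E
  exact (measurable_uncurry_of_continuous_of_measurable (u := fun x z => M.constr z x)
    M.continuous_constr M.measurable_constr).comp (hx.prodMk hg)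

section MeasurableOpt

variable [Finite ι]

lemma measurableSet_exists_mem_feas {Ω : Type*} [MeasurableSpace Ω] {z : Ω → ι → Z}
    (hz : Measurable z) {A : Set E} (hA : IsClosed A) {v : Ω → ℝ} (hv : Measurable v) :
    MeasurableSet {ω | ∃ x ∈ A, x ∈ M.feas (z ω) ∧ M.obj x ≤ v ω} := by
  have := Fintype.ofFinite ι
  let F : Ω → E → ℝ := fun ω x => (∑ i, max (M.constr (z ω i) x) 0) + max (M.obj x - v ω) 0
  have hF : {ω | ∃ x ∈ A, x ∈ M.feas (z ω) ∧ M.obj x ≤ v ω} =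
      {ω | ∃ x ∈ M.domain ∩ A, F ω x ≤ 0} := by
    have hiff (ω : Ω) (x : E) : F ω x ≤ 0 ↔ (∀ i, M.constr (z ω i) x ≤ 0) ∧ M.obj x ≤ v ω := by
      have h1 : 0 ≤ ∑ i, max (M.constr (z ω i) x) 0 := Finset.sum_nonneg fun i _ => le_max_right _ _
      have h2 : 0 ≤ max (M.obj x - v ω) 0 := le_max_right _ _
      rw [(add_nonneg h1 h2).ge_iff_eq', add_eq_zero_iff_of_nonneg h1 h2,
        Finset.sum_eq_zero_iff_of_nonneg fun i _ => le_max_right _ _]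
      simp
    ext ω
    simp only [Set.mem_ofPred_eq, hiff, feas, Set.mem_inter_iff]
    exact exists_congr fun x => by tauto
  rw [hF]
  refine measurableSet_exists_mem_nonpos (M.isCompact_domain.inter_right hA) (fun ω => ?_)
    fun x => ?_
  · have := M.continuous_obj
    have := fun i => M.continuous_constr (z ω i)
    fun_prop
  · have h (i : ι) : Measurable fun ω => M.constr (z ω i) x :=
      (M.measurable_constr x).comp ((measurable_pi_apply i).comp hz)
    fun_prop

lemma measurable_obj_opt : Measurable fun z : ι → Z => M.obj (M.opt z) := by
  refine measurable_of_Iic fun r => ?_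
  convert M.measurableSet_exists_mem_feas (measurable_id (α := ι → Z)) isClosed_univ
    (measurable_const (a := r)) using 1
  ext z
  exact ⟨fun h => ⟨M.opt z, trivial, M.opt_mem z, h⟩,
    fun ⟨x, _, hx, hr⟩ => (M.isMinOn_opt z hx).trans hr⟩

variable [MeasurableSpace E] [BorelSpace E]

lemma measurable_opt : Measurable fun z : ι → Z => M.opt z := by
  refine measurable_of_isClosed fun A hA => ?_
  convert M.measurableSet_exists_mem_feas (measurable_id (α := ι → Z)) hA M.measurable_obj_opt
    using 1
  ext z
  exact ⟨fun h => ⟨M.opt z, h, M.opt_mem z, le_rfl⟩,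
    fun ⟨x, hxA, hx, hle⟩ => Set.mem_preimage.2 (eq_opt hx hle ▸ hxA)⟩

end MeasurableOpt

end ConvexScenario

section IndependentCopies

variable {Z : Type*} [MeasurableSpace Z] {Q : Measure Z} [IsProbabilityMeasure Q]

lemma ae_pi_injective {κ : Type*} [Fintype κ] {X : Z → ℝ} (hX : Measurable X)
    (h : ∀ r, Q {z | X z = r} = 0) :
    ∀ᵐ v ∂Measure.pi fun _ : κ => Q, Function.Injective fun i => X (v i) := by
  have hatoms : NullSingletonClass (Q.map X) :=
    ⟨fun r => by rw [Measure.map_apply hX (measurableSet_singleton r)]; exact h r⟩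
  have hne (i j : κ) (hij : i ≠ j) : ∀ᵐ v ∂Measure.pi fun _ : κ => Q, X (v i) ≠ X (v j) := by
    have hmap (i : κ) : (Measure.pi fun _ : κ => Q).map (fun v => X (v i)) = Q.map X := by
      exact (Measure.map_map hX (measurable_pi_apply i)).symm.trans
        (congrArg (Measure.map X) (measurePreserving_eval (fun _ : κ => Q) i).map_eq)
    have hindep := (ProbabilityTheory.iIndepFun_pi (μ := fun _ : κ => Q) (X := fun _ => X)
      fun _ => hX.aemeasurable).indepFun hij
    have hXi (i : κ) : Measurable fun v : κ → Z => X (v i) := hX.comp (measurable_pi_apply i)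
    rw [ProbabilityTheory.indepFun_iff_map_prod_eq_prod_map_map (hXi i).aemeasurable
      (hXi j).aemeasurable, hmap, hmap] at hindep
    have hdiag : ∀ᵐ p ∂(Q.map X).prod (Q.map X), p.1 ≠ p.2 := by
      have hset : MeasurableSet {p : ℝ × ℝ | p.1 ≠ p.2} :=
        (measurableSet_eq_fun measurable_fst measurable_snd).compl
      exact (Measure.ae_prod_iff_ae_ae hset).2 (.of_forall fun r =>
        (Measure.ae_ne _ r).mono fun _ => Ne.symm)
    rw [← hindep] at hdiag
    exact ae_of_ae_map ((hXi i).prodMk (hXi j)).aemeasurable hdiag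
  filter_upwards [ae_all_iff.2 fun i => ae_all_iff.2 fun j => ae_all_iff.2 (hne i j)] with v hv
  exact fun i j hij => of_not_not fun hne => hv i j hne hij

lemma ae_pi_forall {κ : Type*} [Fintype κ] {p : Z → Prop} (h : ∀ᵐ z ∂Q, p z) :
    ∀ᵐ v ∂Measure.pi fun _ : κ => Q, ∀ i, p (v i) :=
  ae_all_iff.2 fun i => (measurePreserving_eval (fun _ : κ => Q) i).quasiMeasurePreserving.ae h

lemma measurePreserving_restrict_prodMk_restrict_compl {ι : Type*} [Fintype ι] [DecidableEq ι]
    (I : Finset ι) :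
    MeasurePreserving (fun z : ι → Z => (I.restrict z, fun j : {i // i ∉ I} => z j))
      (Measure.pi fun _ => Q) ((Measure.pi fun _ => Q).prod (Measure.pi fun _ => Q)) := by
  convert measurePreserving_piEquivPiSubtypeProd (fun _ : ι => Q) (· ∈ I) <;> rfl

lemma measureReal_prod_eq_integral {Ω Ω' : Type*} [MeasurableSpace Ω] [MeasurableSpace Ω']
    (μ : Measure Ω) (ν : Measure Ω') [IsFiniteMeasure ν] {s : Set (Ω × Ω')}
    (hs : MeasurableSet s) : (μ.prod ν).real s = ∫ x, ν.real (Prod.mk x ⁻¹' s) ∂μ := by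
  rw [measureReal_def, Measure.prod_apply hs]
  exact (integral_toReal (measurable_measure_prodMk_left hs).aemeasurable
    (.of_forall fun _ => measure_lt_top _ _)).symm

end IndependentCopies

lemma exists_top_subset {ι : Type*} [Fintype ι] {φ : ι → ℝ} {I : Finset ι}
    (hlt : ∀ i ∈ I, ∀ j ∉ I, φ j < φ i) (hinj : Set.InjOn φ (I : Set ι)ᶜ) {k : ℕ}
    (hk : I.card ≤ k) (hk' : k ≤ Fintype.card ι) :
    ∃ T : Finset ι, I ⊆ T ∧ T.card = k ∧ ∀ i ∈ T, ∀ j ∉ T, φ j < φ i := by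
  classical
  induction k, hk using Nat.le_induction with
  | base => exact ⟨I, subset_rfl, rfl, hlt⟩
  | succ k _ ih =>
    obtain ⟨T, hIT, hcard, hT⟩ := ih (by omega)
    have hne : Tᶜ.Nonempty := by
      rw [← Finset.card_pos, Finset.card_compl]
      omega
    obtain ⟨l, hl, hmax⟩ := Tᶜ.exists_max_image φ hne
    rw [Finset.mem_compl] at hl
    refine ⟨insert l T, hIT.trans (Finset.subset_insert _ _), ?_, fun i hi j hj => ?_⟩
    · rw [Finset.card_insert_of_notMem hl, hcard]
    rw [Finset.mem_insert, not_or] at hj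
    rcases Finset.mem_insert.1 hi with rfl | hi
    · exact (hmax j (Finset.mem_compl.2 hj.2)).lt_of_ne fun h =>
        hj.1 (hinj (fun h => hj.2 (hIT h)) (fun h => hl (hIT h)) h)
    · exact hT i hi j hj.2

namespace ConvexScenario

variable {Z E : Type*} [MeasurableSpace Z] [NormedAddCommGroup E] [NormedSpace ℝ E]
  (M : ConvexScenario Z E) {ι κ : Type*}

/-- The scenarios whose constraint has more slack at the optimizer for the `w i` than each of the
constraints `w i`. -/
def slackerSet (w : ι → Z) : Set Z := {x | ∀ i, M.constr x (M.opt w) < M.constr (w i) (M.opt w)}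

/-- The probability of `slackerSet`; for a nonempty family, one minus this number bounds the
probability that a new scenario is violated at the optimizer. -/
noncomputable def slackProb (Q : Measure Z) (w : ι → Z) : ℝ := Q.real (M.slackerSet w)

/-- All constraints outside `I` have more slack than those of `I` at the optimizer for `I`. -/
def Dominates (I : Finset ι) (z : ι → Z) : Prop := ∀ j ∉ I, z j ∈ M.slackerSet (I.restrict z)

section Reindexing

lemma opt_comp_equiv (e : κ ≃ ι) (w : ι → Z) : M.opt (w ∘ e) = M.opt w := by
  have hfeas : M.feas (w ∘ e) = M.feas w := by
    ext x
    exact and_congr_right fun _ => e.forall_congr_left (p := fun i => M.constr ((w ∘ e) i) x ≤ 0)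
      |>.trans (by simp)
  exact opt_eq_of_feas_subset hfeas.symm.subset (hfeas ▸ M.opt_mem _)

lemma slackerSet_comp_equiv (e : κ ≃ ι) (w : ι → Z) : M.slackerSet (w ∘ e) = M.slackerSet w := by
  ext x
  simp only [slackerSet, Set.mem_ofPred_eq, M.opt_comp_equiv e w]
  exact ⟨fun h i => by simpa using h (e.symm i), fun h i => h (e i)⟩

lemma integral_slackProb_reindex (Q : Measure Z) [SigmaFinite Q] [Fintype ι] [Fintype κ]
    (e : κ ≃ ι) (φ : ℝ → ℝ) : ∫ w : ι → Z, φ (M.slackProb Q w) ∂Measure.pi (fun _ => Q) =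
      ∫ w : κ → Z, φ (M.slackProb Q w) ∂Measure.pi (fun _ => Q) := by
  have hmp := (measurePreserving_piCongrLeft (fun _ : ι => Q) e).symm
  rw [← hmp.integral_comp']
  refine integral_congr_ae (.of_forall fun w => ?_)
  exact congrArg (fun s => φ (Q.real s)) (M.slackerSet_comp_equiv e w).symm

end Reindexing

section Dominates

variable {M} {I J : Finset ι} {z : ι → Z}

lemma Dominates.opt_eq (h : M.Dominates I z) (hI : I.Nonempty) :
    M.opt (I.restrict z) = M.opt z := by
  refine opt_eq_of_feas_subset (M.feas_subset_feas_restrict z I) ⟨(M.opt_mem _).1, fun j => ?_⟩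
  by_cases hj : j ∈ I
  · exact M.constr_opt_nonpos (I.restrict z) ⟨j, hj⟩
  · obtain ⟨i, hi⟩ := hI
    exact (h j hj ⟨i, hi⟩).le.trans (M.constr_opt_nonpos (I.restrict z) ⟨i, hi⟩)

lemma Dominates.constr_lt (h : M.Dominates I z) {i j : ι} (hi : i ∈ I) (hj : j ∉ I) :
    M.constr (z j) (M.opt z) < M.constr (z i) (M.opt z) := by
  rw [← h.opt_eq ⟨i, hi⟩]
  exact h j hj ⟨i, hi⟩

lemma Dominates.unique (hI : M.Dominates I z) (hJ : M.Dominates J z) (hcard : I.card = J.card) :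
    I = J := by
  classical
  by_contra hne
  have hIJ : (I \ J).Nonempty := Finset.sdiff_nonempty.2 fun h =>
    hne (Finset.eq_of_subset_of_card_le h hcard.ge)
  have hJI : (J \ I).Nonempty := Finset.sdiff_nonempty.2 fun h =>
    hne (Finset.eq_of_subset_of_card_le h hcard.le).symm
  obtain ⟨i, hi⟩ := hIJ
  obtain ⟨j, hj⟩ := hJI
  rw [Finset.mem_sdiff] at hi hj
  exact lt_asymm (hI.constr_lt hi.1 hj.2) (hJ.constr_lt hj.1 hi.2)

lemma Dominates.violated_subset_compl_slackerSet (h : M.Dominates I z) (hI : I.Nonempty) :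
    {x | 0 < M.constr x (M.opt z)} ⊆ (M.slackerSet (I.restrict z))ᶜ := by
  obtain ⟨i, hi⟩ := hI
  intro x hx hslack
  have h1 : M.constr x (M.opt (I.restrict z)) < 0 :=
    (hslack ⟨i, hi⟩).trans_le (M.constr_opt_nonpos (I.restrict z) ⟨i, hi⟩)
  rw [h.opt_eq ⟨i, hi⟩] at h1
  exact lt_asymm h1 hx

end Dominates

section Risk

variable [FiniteDimensional ℝ E] [MeasurableSpace E] [BorelSpace E] (Q : Measure Z)

lemma measurableSet_mem_slackerSet [Finite ι] {Ω : Type*} [MeasurableSpace Ω] {g : Ω → Z}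
    {w : Ω → ι → Z} (hg : Measurable g) (hw : Measurable w) :
    MeasurableSet {ω | g ω ∈ M.slackerSet (w ω)} := by
  have hopt : Measurable fun ω => M.opt (w ω) := M.measurable_opt.comp hw
  have : {ω | g ω ∈ M.slackerSet (w ω)} =
      ⋂ i, {ω | M.constr (g ω) (M.opt (w ω)) < M.constr (w ω i) (M.opt (w ω))} := by
    ext ω
    simp [slackerSet]
  rw [this]
  exact .iInter fun i => measurableSet_lt (M.measurable_constr_comp hg hopt)
    (M.measurable_constr_comp ((measurable_pi_apply i).comp hw) hopt)

lemma measurable_slackProb [SFinite Q] [Finite ι] :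
    Measurable fun w : ι → Z => M.slackProb Q w :=
  (measurable_measure_prodMk_left (ν := Q)
    (M.measurableSet_mem_slackerSet measurable_snd measurable_fst)).ennreal_toReal

variable [IsProbabilityMeasure Q]

variable {M Q} in
lemma Dominates.risk_le {I : Finset ι} {z : ι → Z} (h : M.Dominates I z) (hI : I.Nonempty) :
    Q.real {x | 0 < M.constr x (M.opt z)} ≤ 1 - M.slackProb Q (I.restrict z) := by
  have hmeas : MeasurableSet (M.slackerSet (I.restrict z)) :=
    M.measurableSet_mem_slackerSet measurable_id measurable_const
  rw [slackProb, ← probReal_compl_eq_one_sub hmeas]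
  exact measureReal_mono (h.violated_subset_compl_slackerSet hI)

variable [Fintype ι]

lemma measureReal_dominates [DecidableEq ι] (I : Finset ι) {A : Set ℝ} (hA : MeasurableSet A) :
    MeasurableSet {z | M.Dominates I z ∧ M.slackProb Q (I.restrict z) ∈ A} ∧
    (Measure.pi fun _ : ι => Q).real {z | M.Dominates I z ∧ M.slackProb Q (I.restrict z) ∈ A} =
      ∫ w : I → Z, A.indicator (· ^ Iᶜ.card) (M.slackProb Q w) ∂Measure.pi fun _ => Q := by
  let T : Set ((I → Z) × ({i // i ∉ I} → Z)) :=
    {p | (∀ j, p.2 j ∈ M.slackerSet p.1) ∧ M.slackProb Q p.1 ∈ A}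
  have hT : MeasurableSet T := by
    simp only [T, Set.ofPred_and, Set.ofPred_forall]
    exact .inter (.iInter fun j => M.measurableSet_mem_slackerSet
      ((measurable_pi_apply j).comp measurable_snd) measurable_fst)
      ((M.measurable_slackProb Q).comp measurable_fst hA)
  have hmp := measurePreserving_restrict_prodMk_restrict_compl (Q := Q) I
  have hset : {z | M.Dominates I z ∧ M.slackProb Q (I.restrict z) ∈ A} =
      (fun z => (I.restrict z, fun j : {i // i ∉ I} => z j)) ⁻¹' T := by
    ext z
    exact and_congr_left fun _ => ⟨fun h j => h j.1 j.2, fun h j hj => h ⟨j, hj⟩⟩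
  have hsection (w : I → Z) : (Measure.pi fun _ : {i // i ∉ I} => Q).real (Prod.mk w ⁻¹' T) =
      A.indicator (· ^ Iᶜ.card) (M.slackProb Q w) := by
    by_cases hw : M.slackProb Q w ∈ A
    · have : Prod.mk w ⁻¹' T = Set.univ.pi fun _ => M.slackerSet w := by
        ext v
        simp [T, hw]
      rw [Set.indicator_of_mem hw, this, measureReal_def, Measure.pi_pi, ENNReal.toReal_prod,
        Finset.prod_const, Finset.card_univ, Fintype.card_subtype_compl, Fintype.card_coe,
        Finset.card_compl]
      rfl
    · have : Prod.mk w ⁻¹' T = ∅ := by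
        ext v
        simp [T, hw]
      rw [Set.indicator_of_notMem hw, this, measureReal_empty]
  refine ⟨hset ▸ hmp.measurable hT, ?_⟩
  rw [hset, hmp.measureReal_preimage hT.nullMeasurableSet, measureReal_prod_eq_integral _ _ hT]
  exact integral_congr_ae (.of_forall hsection)

lemma measureReal_exists_dominates {k m : ℕ} (hN : Fintype.card ι = k + m) {A : Set ℝ}
    (hA : MeasurableSet A) :
    (Measure.pi fun _ : ι => Q).real
        {z | ∃ I : Finset ι, I.card = k ∧ M.Dominates I z ∧ M.slackProb Q (I.restrict z) ∈ A} =
      (k + m).choose k *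
        ∫ w : Fin k → Z, A.indicator (· ^ m) (M.slackProb Q w) ∂Measure.pi fun _ => Q := by
  classical
  have hunion :
      {z | ∃ I : Finset ι, I.card = k ∧ M.Dominates I z ∧ M.slackProb Q (I.restrict z) ∈ A} =
        ⋃ I ∈ Finset.powersetCard k Finset.univ,
          {z : ι → Z | M.Dominates I z ∧ M.slackProb Q (I.restrict z) ∈ A} := by
    ext z
    simp [Finset.mem_powersetCard, and_left_comm]
  have hint (I : Finset ι) (hI : I ∈ Finset.powersetCard k Finset.univ) :
      (Measure.pi fun _ : ι => Q).real {z | M.Dominates I z ∧ M.slackProb Q (I.restrict z) ∈ A} =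
        ∫ w : Fin k → Z, A.indicator (· ^ m) (M.slackProb Q w) ∂Measure.pi fun _ => Q := by
    have hcard : I.card = k := (Finset.mem_powersetCard.1 hI).2
    have hcompl : Iᶜ.card = m := by
      rw [Finset.card_compl]
      omega
    rw [(M.measureReal_dominates Q I hA).2, hcompl]
    exact M.integral_slackProb_reindex Q (I.equivFinOfCardEq hcard).symm _
  rw [hunion, measureReal_biUnion_finset, Finset.sum_congr rfl hint, Finset.sum_const,
    Finset.card_powersetCard, Finset.card_univ, hN, nsmul_eq_mul]
  · intro I hI J hJ hne
    refine Set.disjoint_left.2 fun z hzI hzJ => hne (hzI.1.unique hzJ.1 ?_)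
    rw [(Finset.mem_powersetCard.1 hI).2, (Finset.mem_powersetCard.1 hJ).2]
  · exact fun I _ => (M.measureReal_dominates Q I hA).1

/-- The constraint functions have atomless laws. -/
def Atomless (Q : Measure Z) : Prop := ∀ x r, Q {z | M.constr z x = r} = 0

variable {M Q}

lemma Atomless.ae_generic (hQ : M.Atomless Q) (I : Finset ι) :
    ∀ᵐ z ∂Measure.pi fun _ : ι => Q,
      (∀ j ∉ I, M.constr (z j) (M.opt (I.restrict z)) ≠ 0) ∧
        Set.InjOn (fun j => M.constr (z j) (M.opt (I.restrict z))) (I : Set ι)ᶜ := by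
  classical
  let S : Set ((I → Z) × ({i // i ∉ I} → Z)) :=
    {p | (∀ j, M.constr (p.2 j) (M.opt p.1) ≠ 0) ∧
      Function.Injective fun j => M.constr (p.2 j) (M.opt p.1)}
  have hS : MeasurableSet S := by
    have hconstr (j : {i // i ∉ I}) : Measurable fun p : (I → Z) × ({i // i ∉ I} → Z) =>
        M.constr (p.2 j) (M.opt p.1) :=
      M.measurable_constr_comp (by fun_prop) (M.measurable_opt.comp measurable_fst)
    simp only [S, Function.Injective, Set.ofPred_and, Set.ofPred_forall]
    exact .inter (.iInter fun j => (measurableSet_eq_fun (hconstr j) measurable_const).compl)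
      (.iInter fun j => .iInter fun j' => (measurableSet_eq_fun (hconstr j) (hconstr j')).imp
        (.const _))
  have hae : ∀ᵐ p ∂(Measure.pi fun _ : I => Q).prod (Measure.pi fun _ : {i // i ∉ I} => Q),
      p ∈ S := by
    refine (Measure.ae_prod_mem_iff_ae_ae_mem hS).2 (.of_forall fun w => ?_)
    have hne : ∀ᵐ x ∂Q, M.constr x (M.opt w) ≠ 0 := by
      simpa [ae_iff] using hQ (M.opt w) 0
    exact (ae_pi_forall hne).and (ae_pi_injective (M.measurable_constr (M.opt w)) (hQ (M.opt w)))
  filter_upwards [(measurePreserving_restrict_prodMk_restrict_compl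
    I).quasiMeasurePreserving.ae hae] with z hz
  exact ⟨fun j hj => hz.1 ⟨j, hj⟩, fun j hj j' hj' h =>
    congrArg Subtype.val (@hz.2 ⟨j, hj⟩ ⟨j', hj'⟩ h)⟩

lemma Atomless.ae_exists_dominates (hQ : M.Atomless Q)
    (hcard : Module.finrank ℝ E ≤ Fintype.card ι) :
    ∀ᵐ z ∂Measure.pi fun _ : ι => Q,
      ∃ I : Finset ι, I.card = Module.finrank ℝ E ∧ M.Dominates I z := by
  filter_upwards [ae_all_iff.2 hQ.ae_generic] with z hz
  obtain ⟨I, hIcard, hactive, hopt⟩ := M.exists_active_opt_restrict_eq z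
  obtain ⟨hne, hinj⟩ := hz I
  rw [hopt] at hne hinj
  have hlt : ∀ i ∈ I, ∀ j ∉ I, M.constr (z j) (M.opt z) < M.constr (z i) (M.opt z) := by
    intro i hi j hj
    rw [hactive i hi]
    exact (M.constr_opt_nonpos z j).lt_of_ne (hne j hj)
  obtain ⟨T, hIT, hTcard, hT⟩ := exists_top_subset hlt hinj hIcard hcard
  have hTopt : M.opt (T.restrict z) = M.opt z := by
    rw [← hopt]
    refine (opt_eq_of_feas_subset (M.feas_restrict_subset_feas_restrict z hIT) ?_).symm
    rw [hopt]
    exact M.feas_subset_feas_restrict z T (M.opt_mem z)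
  refine ⟨T, hTcard, fun j hj i => ?_⟩
  rw [hTopt]
  exact hT i i.2 j hj

lemma Atomless.choose_mul_integral_slackProb_pow (hQ : M.Atomless Q) (m : ℕ) :
    ((Module.finrank ℝ E + m).choose (Module.finrank ℝ E) : ℝ) *
      ∫ w : Fin (Module.finrank ℝ E) → Z, M.slackProb Q w ^ m ∂Measure.pi (fun _ => Q) = 1 := by
  have hall := M.measureReal_exists_dominates Q (Fintype.card_fin (Module.finrank ℝ E + m))
    MeasurableSet.univ
  simp only [Set.mem_univ, and_true, Set.indicator_univ] at hall
  rw [← hall, measureReal_congr (Filter.eventuallyEq_univ.2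
    (hQ.ae_exists_dominates (ι := Fin (Module.finrank ℝ E + m)) (by simp))), probReal_univ]

theorem Atomless.measureReal_risk_gt_le (hQ : M.Atomless Q) (hE : 0 < Module.finrank ℝ E) {ε : ℝ}
    (h0 : 0 ≤ ε) (h1 : ε ≤ 1) :
    (Measure.pi fun _ : ι => Q).real {z | ε < Q.real {x | 0 < M.constr x (M.opt z)}} ≤
      binomTail (Module.finrank ℝ E) (Fintype.card ι) ε := by
  rcases Nat.lt_or_ge (Fintype.card ι) (Module.finrank ℝ E) with hN | hN
  · rw [binomTail_of_lt hN]
    exact measureReal_le_one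
  obtain ⟨m, hm⟩ := Nat.exists_eq_add_of_le hN
  obtain ⟨n, hn⟩ : ∃ n, Module.finrank ℝ E = n + 1 := ⟨_, (Nat.sub_add_cancel hE).symm⟩
  have hmoment := hQ.choose_mul_integral_slackProb_pow
  have hdominates := hQ.ae_exists_dominates hN
  have hdom := M.measureReal_exists_dominates Q hm (measurableSet_Iio (a := 1 - ε))
  rw [hn] at hmoment hdominates hdom
  have hmeas := M.measurable_slackProb Q (ι := Fin (n + 1))
  have hlt : MeasurableSet {w : Fin (n + 1) → Z | M.slackProb Q w < 1 - ε} :=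
    measurableSet_lt hmeas measurable_const
  have hlaw := choose_mul_setIntegral_pow_of_moments hmeas
    (fun w => ⟨measureReal_nonneg, measureReal_le_one⟩) hmoment (sub_nonneg.2 h1)
    (sub_le_self 1 h0) m
  rw [sub_sub_cancel, ← integral_indicator hlt] at hlaw
  rw [hm, hn, ← hlaw]
  refine (ENNReal.toReal_mono (measure_ne_top _ _) (measure_mono_ae ?_)).trans_eq hdom
  filter_upwards [hdominates] with z ⟨I, hI, hz⟩ hε
  have hne : I.Nonempty := Finset.card_pos.1 (by omega)
  exact ⟨I, hI, hz, lt_sub_comm.1 (hε.trans_le (hz.risk_le hne))⟩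

end Risk

end ConvexScenario

section DualNorm

variable {X C : Type*} [NormedAddCommGroup X] [NormedSpace ℝ X] [AddCommGroup C] [Module ℝ C]
  {p : X →ₗ[ℝ] C →ₗ[ℝ] ℝ}

lemma IsDualPair.le_dualNorm (hp : IsDualPair p) {x : X} (hx : ‖x‖ ≤ 1) (c : C) :
    p x c ≤ dualNorm p c :=
  le_csSup (hp.bddAbove c) ⟨x, hx, rfl⟩

lemma dualNorm_le {c : C} {r : ℝ} (h : ∀ x, ‖x‖ ≤ 1 → p x c ≤ r) : dualNorm p c ≤ r :=
  csSup_le ⟨_, 0, by simp, rfl⟩ (by rintro _ ⟨x, hx, rfl⟩; exact h x hx)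

lemma IsDualPair.dualNorm_nonneg (hp : IsDualPair p) (c : C) : 0 ≤ dualNorm p c := by
  simpa using hp.le_dualNorm (x := 0) (by simp) c

lemma IsDualPair.apply_le (hp : IsDualPair p) (x : X) (c : C) : p x c ≤ ‖x‖ * dualNorm p c := by
  rcases eq_or_ne x 0 with rfl | hx
  · simp
  have hpos : 0 < ‖x‖ := norm_pos_iff.2 hx
  have h := hp.le_dualNorm (x := ‖x‖⁻¹ • x) (by simp [norm_smul, hpos.ne']) c
  rwa [map_smul, LinearMap.smul_apply, smul_eq_mul, inv_mul_le_iff₀ hpos] at h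

lemma IsDualPair.dualNorm_add_le (hp : IsDualPair p) (c d : C) :
    dualNorm p (c + d) ≤ dualNorm p c + dualNorm p d :=
  dualNorm_le fun x hx => by
    rw [map_add]
    exact add_le_add (hp.le_dualNorm hx c) (hp.le_dualNorm hx d)

lemma dualNorm_smul {r : ℝ} (hr : 0 ≤ r) (c : C) :
    dualNorm p (r • c) = r * dualNorm p c := by
  rw [dualNorm, dualNorm, ← smul_eq_mul, ← Real.sSup_smul_of_nonneg hr]
  congr 1
  ext s
  simp [Set.mem_smul_set, eq_comm, ← exists_and_right]

lemma IsDualPair.eq_zero_of_dualNorm_eq_zero (hp : IsDualPair p) {c : C}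
    (h : dualNorm p c = 0) : c = 0 := by
  have hle (x : X) : p x c ≤ 0 := by simpa [h] using hp.apply_le x c
  refine hp.separatingRight c fun x => (hle x).antisymm ?_
  simpa using hle (-x)

end DualNorm

section Separation

variable {E F : Type*} [AddCommGroup E] [Module ℝ E] [AddCommGroup F] [Module ℝ F]
  {p : E →ₗ[ℝ] F →ₗ[ℝ] ℝ}

lemma t2Space_weakBilin_flip (hp : p.SeparatingRight) : T2Space (WeakBilin p.flip) := by
  refine (WeakBilin.isEmbedding (B := p.flip) ?_).t2Space
  exact LinearMap.separatingRight_iff_flip_ker_eq_bot.1 hp |> LinearMap.ker_eq_bot.1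

lemma exists_mem_dual_neg {K : PointedCone ℝ E} (hK : IsWeaklyClosed p (K : Set E)) {x : E}
    (hx : x ∉ K) : ∃ y ∈ PointedCone.dual p (K : Set E), p x y < 0 := by
  let K' : ProperCone ℝ (WeakBilin p) := ⟨K, hK⟩
  obtain ⟨f, hf, hfx⟩ := ProperCone.hyperplane_separation_point K' hx
  obtain ⟨y, rfl⟩ := LinearMap.dualEmbedding_surjective p f
  exact ⟨y, fun k hk => hf k hk, hfx⟩

end Separation

section Seminorm

variable {E : Type*} [NormedAddCommGroup E] [NormedSpace ℝ E] [FiniteDimensional ℝ E]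

lemma continuous_seminorm (p : Seminorm ℝ E) : Continuous p :=
  continuousOn_univ.1 (p.convexOn.continuousOn isOpen_univ)

lemma isCompact_setOf_seminorm_le {p : Seminorm ℝ E} (hp : ∀ x, p x = 0 → x = 0) (r : ℝ) :
    IsCompact {x | p x ≤ r} := by
  have hproper := FiniteDimensional.proper ℝ E
  obtain ⟨k, hk, hsphere⟩ := (isCompact_sphere (0 : E) 1).exists_forall_le'
    (continuous_seminorm p).continuousOn (a := 0) fun x hx =>
      (apply_nonneg p x).lt_of_ne' fun h => by simp [hp x h] at hx
  have hbound (x : E) : k * ‖x‖ ≤ p x := by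
    rcases eq_or_ne x 0 with rfl | hx
    · simp
    have hpos : 0 < ‖x‖ := norm_pos_iff.2 hx
    have h := hsphere (‖x‖⁻¹ • x) (by simp [norm_smul, hpos.ne'])
    rwa [map_smul_eq_mul, norm_inv, norm_norm, inv_mul_eq_div, le_div_iff₀ hpos] at h
  refine (isCompact_closedBall (0 : E) (r / k)).of_isClosed_subset
    (isClosed_le (continuous_seminorm p) continuous_const) fun x hx => ?_
  rw [mem_closedBall_zero_iff, le_div_iff₀' hk]
  exact (hbound x).trans hx

end Seminorm

namespace Program

variable {X C B Y : Type*} [NormedAddCommGroup X] [NormedSpace ℝ X]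
  [AddCommGroup C] [Module ℝ C] [NormedAddCommGroup B] [NormedSpace ℝ B]
  [AddCommGroup Y] [Module ℝ Y] {n : ℕ} (L : Program X C B Y n)

lemma isCompact_setOf_R_le (r : ℝ) : IsCompact {α | L.R α ≤ r} :=
  isCompact_setOf_seminorm_le L.R_definite r

lemma convex_setOf_R_le (r : ℝ) : Convex ℝ {α | L.R α ≤ r} := by
  simpa using L.R.convexOn.convex_le r

lemma bddAbove_of_continuous {g : (Fin n → ℝ) → ℝ} (hg : Continuous g) :
    BddAbove {r : ℝ | ∃ α : Fin n → ℝ, L.R α ≤ 1 ∧ r = g α} := by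
  refine ((L.isCompact_setOf_R_le 1).image hg).bddAbove.mono ?_
  rintro _ ⟨α, hα, rfl⟩
  exact ⟨α, hα, rfl⟩

lemma R_inv_smul_le_one {θ : ℝ} (hθ : 0 < θ) {α : Fin n → ℝ} (hα : L.R α ≤ θ) :
    L.R (θ⁻¹ • α) ≤ 1 := by
  rwa [map_smul_eq_mul, norm_inv, Real.norm_of_nonneg hθ.le, inv_mul_le_iff₀ hθ, mul_one]

lemma dotProduct_le_mul_RDual {θ : ℝ} (hθ : 0 < θ) {α : Fin n → ℝ} (hα : L.R α ≤ θ)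
    (v : Fin n → ℝ) : α ⬝ᵥ v ≤ θ * L.RDual v := by
  have h : (θ⁻¹ • α) ⬝ᵥ v ≤ L.RDual v :=
    le_csSup (L.bddAbove_of_continuous (g := fun α => α ⬝ᵥ v) (by fun_prop))
      ⟨_, L.R_inv_smul_le_one hθ hα, rfl⟩
  rwa [smul_dotProduct, smul_eq_mul, inv_mul_le_iff₀ hθ] at h

lemma mul_RDual_le {θ m : ℝ} (hθ : 0 < θ) {v : Fin n → ℝ}
    (h : ∀ α, L.R α ≤ θ → α ⬝ᵥ v ≤ m) : θ * L.RDual v ≤ m := by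
  rw [← le_div_iff₀' hθ]
  refine csSup_le ⟨0, 0, by simp, by simp⟩ ?_
  rintro _ ⟨α, hα, rfl⟩
  rw [le_div_iff₀' hθ, ← smul_eq_mul, ← smul_dotProduct]
  refine h _ ?_
  rw [map_smul_eq_mul, Real.norm_of_nonneg hθ.le]
  exact mul_le_of_le_one_right hθ.le hα

lemma normY_nonneg (y : Y) : 0 ≤ L.normY y := L.isDualPair_B.dualNorm_nonneg y

lemma pB_An (α : Fin n → ℝ) (y : Y) : L.pB (L.An α) y = α ⬝ᵥ L.AnAdj y := by
  simp [An, AnAdj, dotProduct]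

lemma pB_residual (α : Fin n → ℝ) (y : Y) :
    L.pB (-L.An α + L.b) y = L.pB L.b y - α ⬝ᵥ L.AnAdj y := by
  rw [map_add, map_neg, LinearMap.add_apply, LinearMap.neg_apply, pB_An]
  ring

lemma pB_residual_nonpos {α : Fin n → ℝ} (hα : α ∈ L.feasible) {y : Y} (hy : y ∈ L.dualCone) :
    L.pB (-L.An α + L.b) y ≤ 0 := by
  have h : 0 ≤ L.pB (L.An α - L.b) y := hy hα.1
  rwa [← neg_sub, map_neg, LinearMap.neg_apply, Left.nonneg_neg_iff, sub_eq_neg_add] at h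

lemma exists_mem_dualCone_neg {δ : B} (hδ : δ ∉ L.K) : ∃ y ∈ L.dualCone, L.pB δ y < 0 :=
  exists_mem_dual_neg L.K_closed hδ

lemma bddBelow_cost {S : Set (Fin n → ℝ)} (hS : ∀ α ∈ S, L.R α ≤ L.θP) :
    BddBelow ((fun α => α ⬝ᵥ L.cvec) '' S) :=
  ((L.isCompact_setOf_R_le L.θP).image (f := fun α => α ⬝ᵥ L.cvec) (by fun_prop)).bddBelow.mono
    (Set.image_mono hS)

lemma Jn_le {α : Fin n → ℝ} (hα : α ∈ L.feasible) : L.Jn ≤ α ⬝ᵥ L.cvec :=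
  csInf_le (L.bddBelow_cost fun _ h => h.2) ⟨α, hα, rfl⟩

/-- The Lagrangian of the conic constraint `A_n α - b ∈ K`; the bound `R α ≤ θP` is not
dualized. -/
noncomputable def lagrangian (α : Fin n → ℝ) (y : Y) : ℝ := α ⬝ᵥ L.cvec + L.pB (-L.An α + L.b) y

lemma lagrangian_eq (α : Fin n → ℝ) (y : Y) :
    L.lagrangian α y = α ⬝ᵥ L.cvec + (L.pB L.b y - α ⬝ᵥ L.AnAdj y) := by
  rw [lagrangian, pB_residual]

lemma continuous_lagrangian (y : Y) : Continuous fun α => L.lagrangian α y := by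
  simp only [lagrangian_eq]
  fun_prop

lemma convexOn_lagrangian (y : Y) {s : Set (Fin n → ℝ)} (hs : Convex ℝ s) :
    ConvexOn ℝ s fun α => L.lagrangian α y := by
  refine ⟨hs, fun α _ β _ p q _ _ hpq => le_of_eq ?_⟩
  obtain rfl : q = 1 - p := by linarith
  simp only [lagrangian_eq, add_dotProduct, smul_dotProduct, smul_eq_mul]
  ring

lemma concaveOn_lagrangian (α : Fin n → ℝ) {s : Set Y} (hs : Convex ℝ s) :
    ConcaveOn ℝ s (L.lagrangian α) :=
  (concaveOn_const _ hs).add ((L.pB (-L.An α + L.b)).concaveOn hs)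

lemma exists_lt_lagrangian {v : ℝ} (hv : v < L.Jn) {α : Fin n → ℝ} (hα : L.R α ≤ L.θP) :
    ∃ y ∈ L.dualCone, v < L.lagrangian α y := by
  by_cases hK : L.An α - L.b ∈ L.K
  · exact ⟨0, zero_mem _, by simpa [lagrangian] using hv.trans_le (L.Jn_le ⟨hK, hα⟩)⟩
  obtain ⟨y, hy, hneg⟩ := L.exists_mem_dualCone_neg hK
  have hpos : 0 < L.pB (-L.An α + L.b) y := by
    rwa [neg_add_eq_sub, ← neg_sub, map_neg, LinearMap.neg_apply, neg_pos]
  obtain ⟨r, hr⟩ := exists_nat_gt ((v - α ⬝ᵥ L.cvec) / L.pB (-L.An α + L.b) y)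
  refine ⟨(r : ℝ) • y, L.dualCone.smul_mem r.cast_nonneg hy, ?_⟩
  rw [div_lt_iff₀ hpos, sub_lt_iff_lt_add'] at hr
  rwa [lagrangian, map_smul, smul_eq_mul]

lemma exists_forall_lt_lagrangian {v : ℝ} (hv : v < L.Jn)
    (hne : {α | L.R α ≤ L.θP}.Nonempty) :
    ∃ y ∈ L.dualCone, ∀ α, L.R α ≤ L.θP → v < L.lagrangian α y := by
  classical
  have hcompact := L.isCompact_setOf_R_le L.θP
  have hconvex := L.convex_setOf_R_le L.θP
  have hcone : Convex ℝ (L.dualCone : Set Y) := L.dualCone.convex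
  obtain ⟨t, ht⟩ := hcompact.elim_finite_subcover
    (fun y : L.dualCone => {α | v < L.lagrangian α y})
    (fun y => isOpen_lt continuous_const (L.continuous_lagrangian y))
    (fun α hα => by
      obtain ⟨y, hy, h⟩ := L.exists_lt_lagrangian hv hα
      exact Set.mem_iUnion.2 ⟨⟨y, hy⟩, h⟩)
  refine Sion.exists_lt_iInf_of_lt_iInf_of_finite (F := WeakBilin L.pB.flip) hne hcompact
    (fun y _ => (L.continuous_lagrangian y).lowerSemicontinuous.lowerSemicontinuousOn _)
    (fun y _ => (L.convexOn_lagrangian y hconvex).quasiconvexOn) hcone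
    (fun α _ => Continuous.upperSemicontinuous
      (continuous_const.add (WeakBilin.eval_continuous L.pB.flip _)) |>.upperSemicontinuousOn _)
    (fun α _ => (L.concaveOn_lagrangian α hcone).quasiconcaveOn) hconvex
    (s := Set.range fun y : t => ((y : L.dualCone) : Y)) (Set.finite_range _)
    (Set.range_subset_iff.2 fun y => (y : L.dualCone).2) fun α hα => ?_
  obtain ⟨y, hy, h⟩ := Set.mem_iUnion₂.1 (ht hα)
  exact ⟨y.1, ⟨⟨y, hy⟩, rfl⟩, h⟩

variable {L}

lemma Regular.θP_pos {γ : ℝ} (h : L.Regular γ) : 0 < L.θP :=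
  pos_of_mul_pos_right ((norm_nonneg _).trans_lt h.θP_large) h.γ_pos.le

lemma Regular.thetaD_nonneg {γ : ℝ} (h : L.Regular γ) {JLB : ℝ} (hJ : JLB ≤ L.Jn) :
    0 ≤ L.thetaD γ JLB := by
  obtain ⟨α, hα⟩ := h.feasible_nonempty
  have hcost := hJ.trans ((L.Jn_le hα).trans (L.dotProduct_le_mul_RDual h.θP_pos hα.2 L.cvec))
  exact div_nonneg (sub_nonneg.2 hcost) (sub_nonneg.2 h.θP_large.le)

lemma Regular.normY_le_of_forall_le_lagrangian {γ : ℝ} (h : L.Regular γ) {y : Y}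
    (hy : y ∈ L.dualCone) {v : ℝ} (hv : ∀ α, L.R α ≤ L.θP → v ≤ L.lagrangian α y) :
    L.normY y ≤ L.thetaD γ v := by
  have hb : L.pB L.b y ≤ ‖L.b‖ * L.normY y := L.isDualPair_B.apply_le L.b y
  have hdual : L.θP * L.RDual (L.AnAdj y) ≤ L.θP * L.RDual L.cvec + ‖L.b‖ * L.normY y - v := by
    refine L.mul_RDual_le h.θP_pos fun α hα => ?_
    have hval := hv α hα
    have hcost := L.dotProduct_le_mul_RDual h.θP_pos hα L.cvec
    rw [lagrangian_eq] at hval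
    linarith
  have hinf := mul_le_mul_of_nonneg_left (h.inf_sup y hy) h.θP_pos.le
  rw [thetaD, le_div_iff₀ (sub_pos.2 h.θP_large)]
  linarith

lemma Regular.Jn_sub_le {γ : ℝ} (h : L.Regular γ) {JLB : ℝ} (hJ : JLB ≤ L.Jn) {α : Fin n → ℝ}
    (hα : L.R α ≤ L.θP) {ζ : ℝ} (hζ : 0 ≤ ζ)
    (hviol : ∀ y ∈ L.dualCone, L.pB (-L.An α + L.b) y ≤ ζ * L.normY y) :
    L.Jn - α ⬝ᵥ L.cvec ≤ L.thetaD γ JLB * ζ := by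
  have hbelow (v : ℝ) (hv : v < L.Jn) : v ≤ α ⬝ᵥ L.cvec + ζ * L.thetaD γ v := by
    obtain ⟨y, hy, hdual⟩ := L.exists_forall_lt_lagrangian hv ⟨α, hα⟩
    have hnorm := h.normY_le_of_forall_le_lagrangian hy fun α hα => (hdual α hα).le
    exact (hdual α hα).le.trans <| add_le_add_right
      ((hviol y hy).trans (mul_le_mul_of_nonneg_left hnorm hζ)) _
  have hlimit : L.Jn ≤ α ⬝ᵥ L.cvec + ζ * L.thetaD γ L.Jn := by
    refine ContinuousWithinAt.closure_le (s := Set.Iio L.Jn) (f := id)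
      (g := fun v => α ⬝ᵥ L.cvec + ζ * L.thetaD γ v) ((closure_Iio L.Jn).ge Set.self_mem_Iic)
      continuousWithinAt_id ?_ hbelow
    unfold thetaD
    fun_prop
  have hmono : L.thetaD γ L.Jn ≤ L.thetaD γ JLB :=
    div_le_div_of_nonneg_right (sub_le_sub_left hJ _) (sub_nonneg.2 h.θP_large.le)
  linarith [mul_le_mul_of_nonneg_left hmono hζ]

variable (L)

/-- The unit ball of the dual cone; `extremal` consists of its extreme points of norm one. -/
def dualBall : Set Y := {y | y ∈ L.dualCone ∧ L.normY y ≤ 1}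

lemma convex_dualBall : Convex ℝ L.dualBall := by
  rintro x ⟨hx, hx1⟩ y ⟨hy, hy1⟩ a b ha hb hab
  refine ⟨L.dualCone.convex hx hy ha hb hab, (L.isDualPair_B.dualNorm_add_le _ _).trans ?_⟩
  rw [dualNorm_smul ha, dualNorm_smul hb]
  exact convex_Iic (1 : ℝ) hx1 hy1 ha hb hab

variable {L}

lemma inv_normY_smul_mem_dualBall {y : Y} (hy : y ∈ L.dualCone) (h0 : 0 < L.normY y) :
    (L.normY y)⁻¹ • y ∈ L.dualBall :=
  ⟨L.dualCone.smul_mem (inv_nonneg.2 h0.le) hy,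
    ((dualNorm_smul (inv_nonneg.2 h0.le) y).trans (inv_mul_cancel₀ h0.ne')).le⟩

lemma zero_mem_dualBall : (0 : Y) ∈ L.dualBall :=
  ⟨zero_mem _, dualNorm_le fun x _ => by simp⟩

lemma extremePoints_dualBall_subset : L.dualBall.extremePoints ℝ ⊆ insert 0 L.extremal := by
  intro y hy
  obtain ⟨⟨hyK, hy1⟩, hext⟩ := mem_extremePoints.1 hy
  rcases (L.normY_nonneg y).eq_or_lt' with h0 | h0
  · exact Or.inl (L.isDualPair_B.eq_zero_of_dualNorm_eq_zero h0)
  rcases hy1.eq_or_lt with h1 | h1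
  · exact Or.inr (mem_extremePoints.2 ⟨⟨hyK, h1⟩, fun u hu v hv huv =>
      hext u ⟨hu.1, hu.2.le⟩ v ⟨hv.1, hv.2.le⟩ huv⟩)
  have hseg : y ∈ openSegment ℝ 0 ((L.normY y)⁻¹ • y) :=
    ⟨1 - L.normY y, L.normY y, sub_pos.2 h1, h0, sub_add_cancel _ _, by
      rw [smul_zero, zero_add, smul_inv_smul₀ h0.ne']⟩
  exact Or.inl (hext _ zero_mem_dualBall _ (inv_normY_smul_mem_dualBall hyK h0) hseg).1.symm

lemma le_of_mem_dualBall (hcompact : IsWeaklyCompact L.pB.flip L.dualBall) {δ : B} {ζ : ℝ}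
    (hζ : 0 ≤ ζ) (h : ∀ y ∈ L.extremal, L.pB δ y ≤ ζ) {y : Y} (hy : y ∈ L.dualBall) :
    L.pB δ y ≤ ζ := by
  have := t2Space_weakBilin_flip L.isDualPair_B.separatingRight
  let S : Set (WeakBilin L.pB.flip) := L.dualBall
  have hext : S.extremePoints ℝ ⊆ {y | L.pB δ y ≤ ζ} := fun y hy => by
    rcases extremePoints_dualBall_subset (L := L) hy with rfl | hy
    · exact (map_zero (L.pB δ)).trans_le hζ
    · exact h y hy
  have hconvex : Convex ℝ {y : WeakBilin L.pB.flip | L.pB δ y ≤ ζ} :=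
    convex_halfSpace_le (L.pB δ).isLinear ζ
  have hclosed : IsClosed {y : WeakBilin L.pB.flip | L.pB δ y ≤ ζ} :=
    isClosed_le (WeakBilin.eval_continuous L.pB.flip δ) continuous_const
  have hy' : y ∈ closure (convexHull ℝ (S.extremePoints ℝ)) := by
    rwa [closure_convexHull_extremePoints hcompact L.convex_dualBall]
  exact closure_minimal (convexHull_min hext hconvex) hclosed hy'

lemma le_mul_normY_of_le_extremal (hcompact : IsWeaklyCompact L.pB.flip L.dualBall) {δ : B}
    {ζ : ℝ} (hζ : 0 ≤ ζ) (h : ∀ y ∈ L.extremal, L.pB δ y ≤ ζ) {y : Y} (hy : y ∈ L.dualCone) :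
    L.pB δ y ≤ ζ * L.normY y := by
  rcases (L.normY_nonneg y).eq_or_lt' with h0 | h0
  · rw [L.isDualPair_B.eq_zero_of_dualNorm_eq_zero h0, map_zero]
    exact mul_nonneg hζ (L.normY_nonneg _)
  · have hball := le_of_mem_dualBall hcompact hζ h (inv_normY_smul_mem_dualBall hy h0)
    rwa [map_smul, smul_eq_mul, inv_mul_le_iff₀ h0, mul_comm] at hball

end Program

section Probability

variable {Ω : Type*} [MeasurableSpace Ω] {μ : Measure Ω}

lemma measureReal_mono_ae [IsFiniteMeasure μ] {s t : Set Ω} (h : ∀ᵐ ω ∂μ, ω ∈ s → ω ∈ t) :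
    μ.real s ≤ μ.real t :=
  ENNReal.toReal_mono (measure_ne_top μ t) (measure_mono_ae h)

lemma measureReal_le_of_ae_eventually_mem [IsFiniteMeasure μ] {s : Set Ω} {S : ℕ → Set Ω} {r : ℝ}
    (h : ∀ᵐ ω ∂μ, ω ∈ s → ∀ᶠ k in Filter.atTop, ω ∈ S k) (hS : ∀ k, μ.real (S k) ≤ r) :
    μ.real s ≤ r := by
  let T (i : ℕ) : Set Ω := ⋂ k ≥ i, S k
  have hT : Monotone T := fun i j hij => Set.biInter_subset_biInter_left fun k hk => hij.trans hk
  have hlim := (ENNReal.continuousAt_toReal (measure_ne_top μ _)).tendsto.comp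
    (tendsto_measure_iUnion_atTop (μ := μ) hT)
  refine (measureReal_mono_ae (h.mono fun ω hω hs => ?_)).trans
    (le_of_tendsto' hlim fun i =>
      (measureReal_mono (Set.biInter_subset_of_mem le_rfl)).trans (hS i))
  simpa [T] using Filter.eventually_atTop.1 (hω hs)

lemma probAtLeast_one_sub_iff [IsProbabilityMeasure μ] {s : Set Ω} {β : ℝ} :
    ProbAtLeast μ s (1 - β) ↔ μ.real sᶜ ≤ β := by
  constructor
  · rintro ⟨t, ht, hts, hβ⟩
    rw [← compl_compl t, probReal_compl_eq_one_sub ht.compl] at hβ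
    exact (measureReal_mono (Set.compl_subset_compl.2 hts)).trans (by linarith)
  · intro h
    have ht := measurableSet_toMeasurable μ sᶜ
    refine ⟨_, ht.compl, Set.compl_subset_comm.1 (subset_toMeasurable μ sᶜ), ?_⟩
    rw [probReal_compl_eq_one_sub ht, measureReal_def, measure_toMeasurable]
    exact sub_le_sub_left h 1

lemma ProbAtLeast.mono_ae [IsProbabilityMeasure μ] {s t : Set Ω} {β : ℝ}
    (hs : ProbAtLeast μ s (1 - β)) (h : ∀ᵐ ω ∂μ, ω ∈ s → ω ∈ t) : ProbAtLeast μ t (1 - β) :=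
  probAtLeast_one_sub_iff.2 <| (measureReal_mono_ae (h.mono fun _ => mt)).trans
    (probAtLeast_one_sub_iff.1 hs)

lemma binomTail_le_of_sampleSize_le {n N : ℕ} {ε β : ℝ} (h0 : 0 ≤ ε) (h1 : ε ≤ 1)
    (h : sampleSize n ε β ≤ N) : binomTail n N ε ≤ β := by
  obtain ⟨m, hm⟩ := iInf_lt_iff.1 (h.trans_lt (Nat.cast_lt.2 N.lt_succ_self))
  obtain ⟨hβ, hmN⟩ := iInf_lt_iff.1 hm
  exact (binomTail_antitone n h0 h1 (Nat.lt_succ_iff.1 (Nat.cast_lt.1 hmN))).trans hβ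

/-- The uniform distribution on the unit interval, the noise that makes constraint values
atomless. -/
noncomputable def unif : Measure ℝ := volume.restrict (Set.Icc 0 1)

instance : IsProbabilityMeasure unif := ⟨by simp [unif]⟩

lemma measureReal_pi_eq_prod_unif {Y : Type*} [MeasurableSpace Y] {P : Measure Y}
    [IsProbabilityMeasure P] {N : ℕ} (s : Set (Fin N → Y)) :
    (Measure.pi fun _ : Fin N => P).real s =
      (Measure.pi fun _ : Fin N => P.prod unif).real {z | (fun j => (z j).1) ∈ s} := by
  have hmp := measurePreserving_arrowProdEquivProdArrow Y ℝ (Fin N) (fun _ => P) (fun _ => unif)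
  have h := hmp.measure_preimage_equiv (s ×ˢ Set.univ)
  rw [Measure.prod_prod, measure_univ, mul_one] at h
  rw [measureReal_def, measureReal_def, ← h]
  congr 2
  ext z
  simp [MeasurableEquiv.arrowProdEquivProdArrow, Equiv.arrowProdEquivProdArrow]

end Probability

lemma convexOn_dotProduct {ι : Type*} [Fintype ι] {s : Set (ι → ℝ)} (hs : Convex ℝ s) (v : ι → ℝ) :
    ConvexOn ℝ s fun α => α ⬝ᵥ v :=
  ⟨hs, fun α _ β _ a b _ _ _ => by simp only [add_dotProduct, smul_dotProduct, le_refl]⟩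

lemma strictConvexOn_mul_dotProduct_self {ι : Type*} [Fintype ι] {t : ℝ} (ht : 0 < t) :
    StrictConvexOn ℝ Set.univ fun α : ι → ℝ => t * (α ⬝ᵥ α) := by
  refine ⟨convex_univ, fun α _ β _ hne a b ha hb hab => ?_⟩
  have hpos : 0 < (α - β) ⬝ᵥ (α - β) :=
    (Finset.sum_nonneg fun i _ => mul_self_nonneg _).lt_of_ne'
      (dotProduct_self_eq_zero.not.2 (sub_ne_zero.2 hne))
  have hmul := mul_pos ht (mul_pos (mul_pos ha hb) hpos)
  have hcomm := dotProduct_comm β α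
  obtain rfl : b = 1 - a := by linarith
  simp only [sub_dotProduct, dotProduct_sub, add_dotProduct, dotProduct_add, smul_dotProduct,
    dotProduct_smul, smul_eq_mul] at hmul ⊢
  rw [hcomm] at hmul ⊢
  linarith

namespace Program

open Filter Topology

variable {X C B Y : Type*} [NormedAddCommGroup X] [NormedSpace ℝ X]
  [AddCommGroup C] [Module ℝ C] [NormedAddCommGroup B] [NormedSpace ℝ B]
  [AddCommGroup Y] [Module ℝ Y] {n : ℕ} (L : Program X C B Y n)

lemma mem_feasibleN_iff {N : ℕ} {ω : Fin N → Y} {α : Fin n → ℝ} :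
    α ∈ L.feasibleN ω ↔ (∀ j, L.pB (-L.An α + L.b) (ω j) ≤ 0) ∧ L.R α ≤ L.θP := by
  simp only [feasibleN, Set.mem_ofPred_eq, pB_residual, sub_nonpos]

lemma continuous_pB_residual (y : Y) : Continuous fun α => L.pB (-L.An α + L.b) y := by
  simp only [pB_residual]
  fun_prop

variable [MeasurableSpace Y]

/-- The scenario program whose constraint at `y` is relaxed by `t * u`, with `u` uniform noise, and
whose objective is regularized by `t * α ⬝ᵥ α`.  The absolute value, which plays no role for `y` in
the dual cone and `u ≥ 0` (see `perturbed_constr`), makes `α₀` feasible for all scenarios. -/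
noncomputable def perturbed (hmeas : ∀ v : B, Measurable fun y : Y => L.pB v y)
    {α₀ : Fin n → ℝ} (hα₀ : α₀ ∈ L.feasible) (t : Set.Ioi (0 : ℝ)) :
    ConvexScenario (Y × ℝ) (Fin n → ℝ) where
  domain := {α | L.R α ≤ L.θP}
  isCompact_domain := L.isCompact_setOf_R_le L.θP
  obj α := α ⬝ᵥ L.cvec + t * (α ⬝ᵥ α)
  continuous_obj := by fun_prop
  strictConvexOn_obj :=
    (convexOn_dotProduct (L.convex_setOf_R_le L.θP) L.cvec).add_strictConvexOn
      ((strictConvexOn_mul_dotProduct_self t.2).subset (Set.subset_univ _)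
        (L.convex_setOf_R_le L.θP))
  constr z α := (α₀ - α) ⬝ᵥ L.AnAdj z.1 - |L.pB (-L.An α₀ + L.b) z.1 - t * z.2|
  continuous_constr z := by fun_prop
  convexOn_constr z :=
    ((convexOn_dotProduct (L.convex_setOf_R_le L.θP) (-L.AnAdj z.1)).add_const
      (α₀ ⬝ᵥ L.AnAdj z.1 - |L.pB (-L.An α₀ + L.b) z.1 - t * z.2|)).congr fun α _ => by
        simp only [Pi.add_apply, dotProduct_neg, sub_dotProduct]
        ring
  measurable_constr α := by
    have hadj : Measurable fun z : Y × ℝ => L.AnAdj z.1 :=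
      measurable_pi_lambda _ fun i => (hmeas _).comp measurable_fst
    have hres : Measurable fun z : Y × ℝ => L.pB (-L.An α₀ + L.b) z.1 :=
      (hmeas _).comp measurable_fst
    simp only [dotProduct]
    fun_prop
  exists_common_feasible := ⟨α₀, hα₀.2, fun z => by simp⟩

variable {L} {hmeas : ∀ v : B, Measurable fun y : Y => L.pB v y} {α₀ : Fin n → ℝ}
  {hα₀ : α₀ ∈ L.feasible}

lemma perturbed_constr {t : Set.Ioi (0 : ℝ)} {z : Y × ℝ} (hz : z.1 ∈ L.dualCone) (hz' : 0 ≤ z.2)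
    (α : Fin n → ℝ) :
    (L.perturbed hmeas hα₀ t).constr z α = L.pB (-L.An α + L.b) z.1 - t * z.2 := by
  have hres := L.pB_residual_nonpos hα₀ hz
  have hnoise : 0 ≤ (t : ℝ) * z.2 := mul_nonneg (le_of_lt t.2) hz'
  simp only [perturbed]
  rw [abs_of_nonpos (by linarith), sub_dotProduct, pB_residual, pB_residual]
  ring

variable {P : Measure Y}

lemma atomless_perturbed (hP : ∀ᵐ y ∂P, y ∈ L.dualCone) (t : Set.Ioi (0 : ℝ)) :
    (L.perturbed hmeas hα₀ t).Atomless (P.prod unif) := by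
  intro α r
  have hmeasurable : MeasurableSet {z | (L.perturbed hmeas hα₀ t).constr z α = r} :=
    measurableSet_eq_fun (ConvexScenario.measurable_constr _ α) measurable_const
  rw [Measure.measure_prod_null hmeasurable]
  filter_upwards [hP] with y hy
  rw [unif, Measure.restrict_apply' measurableSet_Icc]
  refine Set.Subsingleton.measure_zero ?_ _
  rintro u ⟨hu, hu0⟩ v ⟨hv, hv0⟩
  have huv := hu.trans hv.symm
  rw [perturbed_constr hy hu0.1, perturbed_constr hy hv0.1, sub_right_inj] at huv
  exact mul_left_cancel₀ t.2.ne' huv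

lemma ae_prod_unif_mem (hP : ∀ᵐ y ∂P, y ∈ L.dualCone) :
    ∀ᵐ z ∂(P.prod unif), z.1 ∈ L.dualCone ∧ 0 ≤ z.2 := by
  have hnoise : ∀ᵐ u ∂unif, u ∈ Set.Icc (0 : ℝ) 1 := ae_restrict_mem measurableSet_Icc
  filter_upwards [Measure.quasiMeasurePreserving_fst.ae hP,
    Measure.quasiMeasurePreserving_snd.ae hnoise] with z hz1 hz2
  exact ⟨hz1, hz2.1⟩

section Limit

variable {τ : ℕ → Set.Ioi (0 : ℝ)} (hτ : Tendsto (fun k => (τ k : ℝ)) atTop (𝓝 0))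
include hτ

lemma tendsto_perturbed_constr {a : ℕ → Fin n → ℝ} {α : Fin n → ℝ}
    (ha : Tendsto a atTop (𝓝 α)) {z : Y × ℝ} (hz : z.1 ∈ L.dualCone ∧ 0 ≤ z.2) :
    Tendsto (fun k => (L.perturbed hmeas hα₀ (τ k)).constr z (a k)) atTop
      (𝓝 (L.pB (-L.An α + L.b) z.1)) := by
  simp only [perturbed_constr hz.1 hz.2]
  simpa using (((L.continuous_pB_residual z.1).tendsto α).comp ha).sub (hτ.mul_const z.2)

lemma tendsto_perturbed_obj {a : ℕ → Fin n → ℝ} {α : Fin n → ℝ} (ha : Tendsto a atTop (𝓝 α)) :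
    Tendsto (fun k => (L.perturbed hmeas hα₀ (τ k)).obj (a k)) atTop (𝓝 (α ⬝ᵥ L.cvec)) := by
  have hlin : Continuous fun β : Fin n → ℝ => β ⬝ᵥ L.cvec := by fun_prop
  have hsq : Continuous fun β : Fin n → ℝ => β ⬝ᵥ β := by fun_prop
  simpa [perturbed] using
    ((hlin.tendsto α).comp ha).add (hτ.mul ((hsq.tendsto α).comp ha))

lemma isOptimizer_of_tendsto_opt {N : ℕ} {z : Fin N → Y × ℝ}
    (hz : ∀ j, (z j).1 ∈ L.dualCone ∧ 0 ≤ (z j).2) {α : Fin n → ℝ}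
    (hα : Tendsto (fun k => (L.perturbed hmeas hα₀ (τ k)).opt z) atTop (𝓝 α)) :
    L.IsOptimizer (fun j => (z j).1) α := by
  refine ⟨L.mem_feasibleN_iff.2 ⟨fun j => ?_, ?_⟩, fun β hβ => ?_⟩
  · exact le_of_tendsto' (tendsto_perturbed_constr hτ hα (hz j))
      fun k => ConvexScenario.constr_opt_nonpos _ z j
  · exact (L.isCompact_setOf_R_le L.θP).isClosed.mem_of_tendsto hα
      (Eventually.of_forall fun k => ((L.perturbed hmeas hα₀ (τ k)).opt_mem z).1)
  · rw [mem_feasibleN_iff] at hβ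
    refine le_of_tendsto_of_tendsto' (tendsto_perturbed_obj hτ hα)
      (tendsto_perturbed_obj hτ tendsto_const_nhds) fun k =>
        ConvexScenario.isMinOn_opt _ z ⟨hβ.2, fun j => ?_⟩
    rw [perturbed_constr (hz j).1 (hz j).2]
    exact sub_nonpos_of_le ((hβ.1 j).trans (mul_nonneg (le_of_lt (τ k).2) (hz j).2))

end Limit

variable (L P) in
/-- The probability that `α` violates the constraint of a new sample. -/
noncomputable def risk (α : Fin n → ℝ) : ℝ := P.real {y | 0 < L.pB (-L.An α + L.b) y}

lemma risk_eq_measureReal_prod_unif (α : Fin n → ℝ) :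
    L.risk P α = (P.prod unif).real {z | 0 < L.pB (-L.An α + L.b) z.1} := by
  have hprod : {z : Y × ℝ | 0 < L.pB (-L.An α + L.b) z.1} =
      {y | 0 < L.pB (-L.An α + L.b) y} ×ˢ Set.univ := by ext; simp
  rw [hprod, measureReal_prod_prod, probReal_univ, mul_one, risk]

variable [IsProbabilityMeasure P]

section Limit

variable {τ : ℕ → Set.Ioi (0 : ℝ)} (hτ : Tendsto (fun k => (τ k : ℝ)) atTop (𝓝 0))
  (hP : ∀ᵐ y ∂P, y ∈ L.dualCone)
include hτ hP

lemma risk_le_of_tendsto {a : ℕ → Fin n → ℝ} {α : Fin n → ℝ} (ha : Tendsto a atTop (𝓝 α)) {ε : ℝ}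
    (hε : ∀ k, (P.prod unif).real
      {x | 0 < (L.perturbed hmeas hα₀ (τ k)).constr x (a k)} ≤ ε) : L.risk P α ≤ ε := by
  rw [risk_eq_measureReal_prod_unif]
  refine measureReal_le_of_ae_eventually_mem ?_ hε
  filter_upwards [ae_prod_unif_mem hP] with x hx hpos
  exact (tendsto_perturbed_constr hτ ha hx).eventually_const_lt hpos

lemma eventually_lt_risk_opt {N : ℕ} {z : Fin N → Y × ℝ}
    (hz : ∀ j, (z j).1 ∈ L.dualCone ∧ 0 ≤ (z j).2) {ε : ℝ}
    (hε : ∀ α, L.IsOptimizer (fun j => (z j).1) α → ε < L.risk P α) :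
    ∀ᶠ k in atTop, ε < (P.prod unif).real {x | 0 < (L.perturbed hmeas hα₀ (τ k)).constr x
      ((L.perturbed hmeas hα₀ (τ k)).opt z)} := by
  by_contra hcon
  obtain ⟨φ, hφ, hle⟩ := extraction_of_frequently_atTop (not_eventually.1 hcon)
  obtain ⟨α, -, ψ, hψ, hα⟩ := (L.isCompact_setOf_R_le L.θP).tendsto_subseq
    fun k => ((L.perturbed hmeas hα₀ (τ (φ k))).opt_mem z).1
  have hτ' := hτ.comp (hφ.tendsto_atTop.comp hψ.tendsto_atTop)
  exact (hε α (isOptimizer_of_tendsto_opt hτ' hz hα)).not_ge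
    (risk_le_of_tendsto hτ' hP hα fun k => not_lt.1 (hle (ψ k)))

end Limit

section ScenarioBound

variable (hmeas) (hne : L.feasible.Nonempty) (hn : 0 < n)
  (hP : ∀ᵐ y ∂P, y ∈ L.dualCone) {N : ℕ} {ε : ℝ} (h0 : 0 ≤ ε) (h1 : ε ≤ 1)
include hmeas hne hn hP h0 h1

theorem measureReal_lt_risk_le :
    (Measure.pi fun _ : Fin N => P).real {ω | ∀ α, L.IsOptimizer ω α → ε < L.risk P α} ≤
      binomTail n N ε := by
  obtain ⟨α₀, hα₀⟩ := hne
  let τ (k : ℕ) : Set.Ioi (0 : ℝ) := ⟨1 / ((k : ℝ) + 1), Set.mem_Ioi.2 Nat.one_div_pos_of_nat⟩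
  have hτ : Tendsto (fun k => (τ k : ℝ)) atTop (𝓝 0) := tendsto_one_div_add_atTop_nhds_zero_nat
  have hbound (k : ℕ) := (atomless_perturbed (hmeas := hmeas) (hα₀ := hα₀) hP
    (τ k)).measureReal_risk_gt_le (ι := Fin N) (by simpa using hn) h0 h1
  simp only [Module.finrank_fin_fun, Fintype.card_fin] at hbound
  rw [measureReal_pi_eq_prod_unif]
  refine measureReal_le_of_ae_eventually_mem ?_ hbound
  filter_upwards [ae_pi_forall (ae_prod_unif_mem hP)] with z hz hrisk
  exact eventually_lt_risk_opt hτ hP hz hrisk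

theorem measureReal_le_risk_le :
    (Measure.pi fun _ : Fin N => P).real {ω | ∀ α, L.IsOptimizer ω α → ε ≤ L.risk P α} ≤
      binomTail n N ε := by
  rcases h0.eq_or_lt with rfl | hpos
  · obtain ⟨m, rfl⟩ := Nat.exists_eq_succ_of_ne_zero hn.ne'
    exact measureReal_le_one.trans_eq (binomTail_zero_right m N).symm
  have hleft : Tendsto (binomTail n N) (𝓝[<] ε) (𝓝 (binomTail n N ε)) :=
    (continuous_binomTail n N).continuousWithinAt
  refine ge_of_tendsto hleft ?_
  filter_upwards [mem_nhdsWithin_of_mem_nhds (Ioi_mem_nhds hpos), self_mem_nhdsWithin]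
    with e he hlt
  refine le_trans (measureReal_mono ?_)
    (measureReal_lt_risk_le hmeas hne hn hP (le_of_lt he) ((le_of_lt hlt).trans h1))
  exact fun ω hω α hα => lt_of_lt_of_le hlt (hω α hα)

lemma probAtLeast_of_risk_le {β : ℝ} {s : Set (Fin N → Y)} (hN : sampleSize n ε β ≤ N)
    (hs : ∀ᵐ ω ∂(Measure.pi fun _ : Fin N => P),
      ∀ α, L.IsOptimizer ω α → L.risk P α ≤ ε → ω ∈ s) :
    ProbAtLeast (Measure.pi fun _ : Fin N => P) s (1 - β) := by
  refine probAtLeast_one_sub_iff.2 <| (measureReal_mono_ae (hs.mono ?_)).trans <|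
    (measureReal_lt_risk_le hmeas hne hn hP h0 h1).trans (binomTail_le_of_sampleSize_le h0 h1 hN)
  exact fun ω hω hbad α hα => not_le.1 fun hrisk => hbad (hω α hα hrisk)

lemma probAtLeast_of_risk_lt {β : ℝ} {s : Set (Fin N → Y)} (hN : sampleSize n ε β ≤ N)
    (hs : ∀ᵐ ω ∂(Measure.pi fun _ : Fin N => P),
      ∀ α, L.IsOptimizer ω α → L.risk P α < ε → ω ∈ s) :
    ProbAtLeast (Measure.pi fun _ : Fin N => P) s (1 - β) := by
  refine probAtLeast_one_sub_iff.2 <| (measureReal_mono_ae (hs.mono ?_)).trans <|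
    (measureReal_le_risk_le hmeas hne hn hP h0 h1).trans (binomTail_le_of_sampleSize_le h0 h1 hN)
  exact fun ω hω hbad α hα => not_lt.1 fun hrisk => hbad (hω α hα hrisk)

end ScenarioBound

end Program

namespace Program

variable {X C B Y : Type*} [NormedAddCommGroup X] [NormedSpace ℝ X]
  [AddCommGroup C] [Module ℝ C] [NormedAddCommGroup B] [NormedSpace ℝ B]
  [AddCommGroup Y] [Module ℝ Y] {n : ℕ} (L : Program X C B Y n)

lemma opNorm_nonneg : 0 ≤ opNorm L.A :=
  Real.sSup_nonneg <| by
    rintro _ ⟨x, -, rfl⟩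
    exact norm_nonneg _

lemma rho_nonneg : 0 ≤ L.rho :=
  Real.sSup_nonneg <| by
    rintro _ ⟨α, -, rfl⟩
    exact Finset.sum_nonneg fun i _ => abs_nonneg _

lemma normBound_nonneg {θ : ℝ} (hθ : 0 ≤ θ) : 0 ≤ θ * L.rho * opNorm L.A + ‖L.b‖ :=
  add_nonneg (mul_nonneg (mul_nonneg hθ L.rho_nonneg) L.opNorm_nonneg) (norm_nonneg _)

lemma sum_abs_le_mul_rho {θ : ℝ} (hθ : 0 < θ) {α : Fin n → ℝ} (hα : L.R α ≤ θ) :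
    ∑ i, |α i| ≤ θ * L.rho := by
  have hscaled : ∑ i, |(θ⁻¹ • α) i| ≤ L.rho :=
    le_csSup (L.bddAbove_of_continuous (g := fun α => ∑ i, |α i|) (by fun_prop))
      ⟨_, L.R_inv_smul_le_one hθ hα, rfl⟩
  simp only [Pi.smul_apply, smul_eq_mul, abs_mul, ← Finset.mul_sum] at hscaled
  rwa [abs_of_pos (inv_pos.2 hθ), inv_mul_le_iff₀ hθ] at hscaled

lemma norm_An_le (hA : BddAbove {r : ℝ | ∃ x : X, ‖x‖ ≤ 1 ∧ r = ‖L.A x‖}) (α : Fin n → ℝ) :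
    ‖L.An α‖ ≤ (∑ i, |α i|) * opNorm L.A := by
  rw [Finset.sum_mul]
  refine norm_sum_le_of_le _ fun i _ => ?_
  rw [norm_smul, Real.norm_eq_abs]
  exact mul_le_mul_of_nonneg_left (le_csSup hA ⟨L.x i, (L.x_norm i).le, rfl⟩) (abs_nonneg _)

lemma norm_residual_le (hA : BddAbove {r : ℝ | ∃ x : X, ‖x‖ ≤ 1 ∧ r = ‖L.A x‖}) {θ : ℝ}
    (hθ : 0 < θ) {α : Fin n → ℝ} (hα : L.R α ≤ θ) :
    ‖-L.An α + L.b‖ ≤ θ * L.rho * opNorm L.A + ‖L.b‖ :=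
  calc ‖-L.An α + L.b‖ ≤ ‖L.An α‖ + ‖L.b‖ := by simpa using norm_add_le (-L.An α) L.b
    _ ≤ (∑ i, |α i|) * opNorm L.A + ‖L.b‖ := by grw [L.norm_An_le hA α]
    _ ≤ θ * L.rho * opNorm L.A + ‖L.b‖ := by
      grw [L.sum_abs_le_mul_rho hθ hα]
      exact L.opNorm_nonneg

variable {L}

lemma mem_dualCone_of_mem_extremal {y : Y} (hy : y ∈ L.extremal) : y ∈ L.dualCone := hy.1.1

lemma Regular.pos_of_mem_extremal {γ : ℝ} (h : L.Regular γ) {y : Y} (hy : y ∈ L.extremal) :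
    0 < n := by
  refine Nat.pos_of_ne_zero ?_
  rintro rfl
  have hinf := h.inf_sup y (mem_dualCone_of_mem_extremal hy)
  have hdual := L.mul_RDual_le (v := L.AnAdj y) (m := 0) one_pos fun α _ => by simp [dotProduct]
  rw [hy.1.2] at hinf
  linarith [h.γ_pos]

lemma JnN_le_Jn (hne : L.feasible.Nonempty) {N : ℕ} {ω : Fin N → Y}
    (hω : ∀ j, ω j ∈ L.dualCone) : L.JnN ω ≤ L.Jn :=
  csInf_le_csInf (L.bddBelow_cost fun _ h => h.2) (hne.image _) <| Set.image_mono fun _ hα =>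
    L.mem_feasibleN_iff.2 ⟨fun j => L.pB_residual_nonpos hα (hω j), hα.2⟩

lemma IsOptimizer.JnN_eq {N : ℕ} {ω : Fin N → Y} {α : Fin n → ℝ} (h : L.IsOptimizer ω α) :
    L.JnN ω = α ⬝ᵥ L.cvec :=
  IsLeast.csInf_eq ⟨Set.mem_image_of_mem _ h.1, Set.forall_mem_image.2 h.2⟩

lemma le_support (δ : B) {y : Y} (hy : y ∈ L.extremal) : L.pB δ y ≤ L.support δ := by
  refine le_csSup ⟨‖δ‖, Set.forall_mem_image.2 fun x hx => ?_⟩ ⟨y, hy, rfl⟩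
  exact (L.isDualPair_B.apply_le δ x).trans_eq (by rw [← normY, hx.1.2, mul_one])

lemma Regular.exists_extremal_div_lt_residual {γ JLB ε : ℝ} {α : Fin n → ℝ}
    (hreg : L.Regular γ)
    (hcompact : IsWeaklyCompact L.pB.flip L.dualBall) (hJ : JLB ≤ L.Jn) (hε : 0 ≤ ε)
    (hα : L.R α ≤ L.θP) (hθ : 0 < L.thetaD γ JLB) (hgap : ε < L.Jn - α ⬝ᵥ L.cvec) :
    ∃ κ ∈ L.extremal, ε / L.thetaD γ JLB < L.pB (-L.An α + L.b) κ := by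
  by_contra! hcon
  have hζ := div_nonneg hε hθ.le
  have hle := hreg.Jn_sub_le hJ hα hζ fun y hy => le_mul_normY_of_le_extremal hcompact hζ hcon hy
  rw [mul_div_cancel₀ _ hθ.ne'] at hle
  exact hgap.not_ge hle

variable [MeasurableSpace Y] {P : Measure Y}

lemma IsTailBound.support_le {h : (Fin n → ℝ) → ℝ → ℝ} (hh : L.IsTailBound P h) {ε : ℝ}
    (hε0 : 0 ≤ ε) (hε1 : ε < 1) {α : Fin n → ℝ} (hrisk : L.risk P α ≤ ε) :
    L.support (-L.An α + L.b) ≤ h α ε := by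
  obtain ⟨hnonneg, htail⟩ := hh α ε hε0 hε1
  rcases le_total (L.support (-L.An α + L.b)) 0 with hsupport | hsupport
  · exact hsupport.trans hnonneg
  · refine htail _ hsupport ?_
    simpa only [tailProb, lt_add_iff_pos_left, risk] using hrisk

section Gap

variable {γ JLB ε : ℝ} {α : Fin n → ℝ}

lemma Regular.gap_le_of_risk_le (hreg : L.Regular γ)
    (hcompact : IsWeaklyCompact L.pB.flip L.dualBall) (hJ : JLB ≤ L.Jn)
    {h : (Fin n → ℝ) → ℝ → ℝ} (hh : L.IsTailBound P h) (hε0 : 0 ≤ ε) (hε1 : ε < 1)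
    (hα : L.R α ≤ L.θP) (hrisk : L.risk P α ≤ ε) :
    L.Jn - α ⬝ᵥ L.cvec ≤ L.thetaD γ JLB * h α ε := by
  have hnonneg := (hh α ε hε0 hε1).1
  refine hreg.Jn_sub_le hJ hα hnonneg fun y hy => ?_
  exact le_mul_normY_of_le_extremal hcompact hnonneg
    (fun κ hκ => (le_support _ hκ).trans (hh.support_le hε0 hε1 hrisk)) hy

lemma Regular.le_risk_of_lt_gap [IsFiniteMeasure P] (hreg : L.Regular γ)
    (hcompact : IsWeaklyCompact L.pB.flip L.dualBall) (hJ : JLB ≤ L.Jn)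
    {m : ℝ} (hm : ‖-L.An α + L.b‖ ≤ m) {q : ℝ} (hε : 0 ≤ ε)
    (hq : ∀ κ ∈ L.extremal,
      q ≤ P.real {y | L.normY (y - κ) < (L.thetaD γ JLB * m)⁻¹ * ε})
    (hα : L.R α ≤ L.θP) (hgap : ε < L.Jn - α ⬝ᵥ L.cvec) : q ≤ L.risk P α := by
  have hprod : 0 < L.thetaD γ JLB * m :=
    calc 0 ≤ ε := hε
      _ < L.Jn - α ⬝ᵥ L.cvec := hgap
      _ ≤ L.thetaD γ JLB * ‖-L.An α + L.b‖ :=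
        hreg.Jn_sub_le hJ hα (norm_nonneg _) fun y _ => L.isDualPair_B.apply_le _ y
      _ ≤ L.thetaD γ JLB * m := mul_le_mul_of_nonneg_left hm (hreg.thetaD_nonneg hJ)
  have hθ : 0 < L.thetaD γ JLB := pos_of_mul_pos_left hprod ((norm_nonneg _).trans hm)
  obtain ⟨κ, hκ, hlt⟩ := hreg.exists_extremal_div_lt_residual hcompact hJ hε hα hθ hgap
  refine (hq κ hκ).trans (measureReal_mono fun y hy => ?_)
  have hclose : L.pB (-L.An α + L.b) κ - L.pB (-L.An α + L.b) y ≤ ε / L.thetaD γ JLB :=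
    calc L.pB (-L.An α + L.b) κ - L.pB (-L.An α + L.b) y
        = L.pB (-(-L.An α + L.b)) (y - κ) := by
          rw [map_neg, LinearMap.neg_apply, map_sub, neg_sub]
      _ ≤ ‖-(-L.An α + L.b)‖ * L.normY (y - κ) := L.isDualPair_B.apply_le _ _
      _ ≤ m * ((L.thetaD γ JLB * m)⁻¹ * ε) := by
        rw [norm_neg]
        exact mul_le_mul hm (le_of_lt hy) (L.normY_nonneg _) ((norm_nonneg _).trans hm)
      _ = ε / L.thetaD γ JLB := by
        have := pos_of_mul_pos_right hprod hθ.le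
        field_simp
  exact sub_lt_self_iff _ |>.1 (hclose.trans_lt hlt)

end Gap

end Program

end ScenarioLP

theorem mainTheorem3_general {X C B Y : Type*} [NormedAddCommGroup X] [NormedSpace ℝ X]
    [AddCommGroup C] [Module ℝ C] [NormedAddCommGroup B] [NormedSpace ℝ B]
    [AddCommGroup Y] [Module ℝ Y] {n : ℕ} (hn : 0 < n) (L : ScenarioLP.Program X C B Y n)
    (hcompact : ScenarioLP.IsWeaklyCompact L.pB.flip {y : Y | y ∈ L.dualCone ∧ L.normY y ≤ 1})
    (γ : ℝ) (hreg : L.Regular γ) (JLB : ℝ) (hJLB : JLB ≤ L.Jn)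
    [MeasurableSpace Y] (hmeas : ∀ v : B, Measurable (fun y : Y => L.pB v y))
    (P : Measure Y) [IsProbabilityMeasure P] (hP : ∀ᵐ y ∂P, y ∈ L.dualCone) :
    (∀ h : (Fin n → ℝ) → ℝ → ℝ, L.IsTailBound P h → ∀ ε β : ℝ, 0 ≤ ε → ε < 1 →
      ∀ N : ℕ, ScenarioLP.sampleSize n ε β ≤ N →
        ScenarioLP.ProbAtLeast (Measure.pi fun _ : Fin N => P)
          {ω | ∃ α, L.IsOptimizer ω α ∧
            0 ≤ L.Jn - L.JnN ω ∧ L.Jn - L.JnN ω ≤ L.thetaD γ JLB * h α ε} (1 - β)) ∧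
    (BddAbove {r : ℝ | ∃ x : X, ‖x‖ ≤ 1 ∧ r = ‖L.A x‖} →
      ∀ g : ℝ → ℝ, L.IsBallBound P g → ∀ ε β : ℝ, 0 ≤ ε →
      ∀ N : ℕ, ScenarioLP.sampleSize n
          (g ((L.thetaD γ JLB * (L.θP * L.rho * ScenarioLP.opNorm L.A + ‖L.b‖))⁻¹ * ε)) β ≤ N →
        ScenarioLP.ProbAtLeast (Measure.pi fun _ : Fin N => P)
          {ω | 0 ≤ L.Jn - L.JnN ω ∧ L.Jn - L.JnN ω ≤ ε} (1 - β)) := by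
  have hne := hreg.feasible_nonempty
  have hlower (N : ℕ) : ∀ᵐ ω ∂(Measure.pi fun _ : Fin N => P), 0 ≤ L.Jn - L.JnN ω :=
    (ScenarioLP.ae_pi_forall hP).mono fun ω hω =>
      sub_nonneg.2 (ScenarioLP.Program.JnN_le_Jn hne hω)
  refine ⟨fun h hh ε β hε0 hε1 N hN => ?_, fun hA g hg ε β hε N hN => ?_⟩
  · refine ScenarioLP.Program.probAtLeast_of_risk_le hmeas hne hn hP hε0 hε1.le hN ?_
    filter_upwards [hlower N] with ω hω α hα hrisk
    refine ⟨α, hα, hω, ?_⟩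
    rw [hα.JnN_eq]
    exact hreg.gap_le_of_risk_le hcompact hJLB hh hε0 hε1 hα.1.2 hrisk
  · have hradius := mul_nonneg (inv_nonneg.2 (mul_nonneg (hreg.thetaD_nonneg hJLB)
      (L.normBound_nonneg hreg.θP_pos.le))) hε
    obtain ⟨hg0, hg1⟩ := hg.mem_unit _ hradius
    refine ScenarioLP.Program.probAtLeast_of_risk_lt hmeas hne hn hP hg0 hg1 hN ?_
    filter_upwards [hlower N] with ω hω α hα
    contrapose!
    intro hgap
    rw [hα.JnN_eq] at hgap hω
    exact hreg.le_risk_of_lt_gap hcompact hJLB (L.norm_residual_le hA hreg.θP_pos hα.1.2) hε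
      (fun κ hκ => hg.le_ball κ hκ _ hradius) hα.1.2 (hgap hω)

theorem mainTheorem3 {X C B Y : Type*} [NormedAddCommGroup X] [NormedSpace ℝ X]
    [AddCommGroup C] [Module ℝ C] [NormedAddCommGroup B] [NormedSpace ℝ B]
    [AddCommGroup Y] [Module ℝ Y] {n : ℕ} (L : ScenarioLP.Program X C B Y n)
    -- the part of the dual unit ball in the dual cone is weakly compact
    (hcompact : ScenarioLP.IsWeaklyCompact L.pB.flip {y : Y | y ∈ L.dualCone ∧ L.normY y ≤ 1})
    -- the regularity assumption and a lower bound of the optimal value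
    (γ : ℝ) (hreg : L.Regular γ) (JLB : ℝ) (hJLB : JLB ≤ L.Jn)
    -- the sampling measure, on a σ-algebra for which the functionals `⟨v, ·⟩` are measurable
    [MeasurableSpace Y] (hmeas : ∀ v : B, Measurable (fun y : Y => L.pB v y))
    (P : MeasureTheory.Measure Y) [MeasureTheory.IsProbabilityMeasure P]
    (hP : ∀ᵐ y ∂P, y ∈ L.extremal) :
    -- the a posteriori bound
    (∀ (h : (Fin n → ℝ) → ℝ → ℝ), L.IsTailBound P h →
      ∀ ε β : ℝ, 0 < ε → ε < 1 → 0 < β →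
      ∀ N : ℕ, ScenarioLP.sampleSize n ε β ≤ N →
      ∀ αstar : (Fin N → Y) → (Fin n → ℝ),
        (∀ᵐ ω ∂(MeasureTheory.Measure.pi fun _ : Fin N => P), L.IsUniqueOptimizer ω (αstar ω)) →
        ScenarioLP.ProbAtLeast (MeasureTheory.Measure.pi fun _ : Fin N => P)
          {ω | 0 ≤ L.Jn - L.JnN ω ∧ L.Jn - L.JnN ω ≤ L.thetaD γ JLB * h (αstar ω) ε} (1 - β)) ∧
    -- the a priori bound
    (BddAbove {r : ℝ | ∃ x : X, ‖x‖ ≤ 1 ∧ r = ‖L.A x‖} →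
      ∀ g : ℝ → ℝ, L.IsBallBound P g →
      ∀ ε β : ℝ, 0 < ε → 0 < β →
      ∀ N : ℕ, ScenarioLP.sampleSize n
          (g ((L.thetaD γ JLB * (L.θP * L.rho * ScenarioLP.opNorm L.A + ‖L.b‖))⁻¹ * ε)) β ≤ N →
        ScenarioLP.ProbAtLeast (MeasureTheory.Measure.pi fun _ : Fin N => P)
          {ω | 0 ≤ L.Jn - L.JnN ω ∧ L.Jn - L.JnN ω ≤ ε} (1 - β)) := by
  have hn : 0 < n := hP.exists.elim fun _ => hreg.pos_of_mem_extremal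
  obtain ⟨hposteriori, hpriori⟩ := mainTheorem3_general hn L hcompact γ hreg JLB hJLB hmeas P
    (hP.mono fun _ => ScenarioLP.Program.mem_dualCone_of_mem_extremal)
  refine ⟨fun h hh ε β hε0 hε1 _ N hN αstar hαstar => ?_,
    fun hA g hg ε β hε _ N hN => hpriori hA g hg ε β hε.le N hN⟩
  refine (hposteriori h hh ε β hε0.le hε1 N hN).mono_ae (hαstar.mono fun ω hω => ?_)
  rintro ⟨α, hα, hgap⟩
  rwa [hω.2 α hα] at hgap
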